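/- Let $q$ be a prime power and let $\mathbb{P}^3(\mathbb{F}_q)$ be the three-dimensional projective space over the field $\mathbb{F}_q$ with $q$ elements. Let $c_{7,3}(q)$ be the number of (labelled) $7$-caps in $\mathbb{P}^3(\mathbb{F}_q)$, i.e. of ordered $7$-tuples of distinct points of $\mathbb{P}^3(\mathbb{F}_q)$ no three of which lie on a line. A planar space $f=(\mathcal{P},\mathcal{L},\mathcal{H})$ consists of a finite set $\mathcal{P}$ of points and sets $\mathcal{L},\mathcal{H}$ of subsets of $\mathcal{P}$ (lines and planes) such that every line has at least two points, any two distinct points lie on exactly one line, and any three distinct non-collinear points lie on exactly one plane. It is written by listing only its full lines (at least $3$ points) and full planes (at least $4$ points); the remaining lines are the pairs of points on no full line, and the remaining planes are the non-collinear triples of points on no full plane. A strong realization of $f$ is an injective map $\sigma:\mathcal{P}\to\mathbb{P}^3(\mathbb{F}_q)$ such that, for every $S\subseteq\mathcal{P}$, $\sigma(S)$ is contained in a line of $\mathbb{P}^3(\mathbb{F}_q)$ if and only if $S$ is contained in a member of $\mathcal{L}$, and $\sigma(S)$ is contained in a plane of $\mathbb{P}^3(\mathbb{F}_q)$ if and only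 if $S$ is contained in a member of $\mathcal{H}$. Let $A_f(4,q)$ be the number of strong realizations of $f$. A hyperfiguration is a planar space in which every point, lying on exactly $i$ full planes and exactly $j$ full lines, satisfies $i\ge 4$, or $j\ge 3$, or $(i,j)=(3,0)$. Consider the following three hyperfigurations. * On the points $0,\dots,5$, with full lines $\{0,1,2\},\{3,4,5\}$ and full planes $\{0,1,2,3\}$, $\{0,1,2,4\}$, $\{0,1,2,5\}$, $\{0,3,4,5\}$, $\{1,3,4,5\}$, $\{2,3,4,5\}$. Its number of strong realizations is denoted $A_6(4,q)$. * $h_5$, on the points $0,\dots,6$, with full lines $\{0,1,2,3\},\{4,5,6\}$ and full planes $\{0,1,2,3,4\}$, $\{0,1,2,3,5\}$, $\{0,1,2,3,6\}$, $\{0,4,5,6\}$, $\{1,4,5,6\}$, $\{2,4,5,6\}$, $\{3,4,5,6\}$. * $h_6$, on the points $0,\dots,6$, with full lines $\{0,1,2\}$, $\{0,3,4\}$, $\{0,5,6\}$, $\{1,3,5\}$, $\{1,4,6\}$, $\{2,3,6\}$, $\{2,4,5\}$ and the single full plane $\{0,1,2,3,4,5,6\}$. Then \begin{align*} c_{7,3}(q)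 ={}& q^{21} + 7q^{20} - 7q^{19} - 112q^{18} - 28q^{17} + 637q^{16} - 119q^{15} - 1840q^{14} + 4676q^{13} - 4949q^{12}\\ & - 1436q^{11} + 4136q^{10} - 107q^9 + 7839q^8 - 5908q^7 - 2184q^6 - 4542q^5 - 3534q^4 + 7470q^3\\ & + (70q^3 + 70q^2 - 560q + 280)\,A_6(4,q) - 105\,A_{h_5}(4,q) - 30\,A_{h_6}(4,q). \end{align*} -/

import Mathlib

/-- The points of `T` lie on a common `d`-dimensional flat of the projective space `ℙ(V)`, that is,
they are all contained in one linear subspace of `V` of dimension `d + 1`. -/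
def LieOnFlat {F V : Type*} [Field F] [AddCommGroup V] [Module F V] (d : ℕ)
    (T : Set (Projectivization F V)) : Prop :=
  ∃ W : Submodule F V, Module.finrank F W = d + 1 ∧ ∀ p ∈ T, p.submodule ≤ W

/-- The points of `T` lie on a common line. -/
def LieOnLine {F V : Type*} [Field F] [AddCommGroup V] [Module F V]
    (T : Set (Projectivization F V)) : Prop := LieOnFlat 1 T

/-- The points of `T` lie on a common plane. -/
def LieOnPlane {F V : Type*} [Field F] [AddCommGroup V] [Module F V]
    (T : Set (Projectivization F V)) : Prop := LieOnFlat 2 T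

/-- A (labelled) cap: the points `σ i` are distinct and no three of them lie on a line. -/
def IsCap {F V ι : Type*} [Field F] [AddCommGroup V] [Module F V]
    (σ : ι → Projectivization F V) : Prop :=
  Function.Injective σ ∧
    ∀ i j k : ι, i ≠ j → i ≠ k → j ≠ k → ¬ LieOnLine ({σ i, σ j, σ k} : Set (Projectivization F V))

/-- `c_{n,k}(q)` for `q = |F|`: the number of `n`-caps in the `k`-dimensional projective space
over `F`, the points of a cap being labelled (ordered). -/
noncomputable def capCount (F : Type*) [Field F] (n k : ℕ) : ℕ :=
  Nat.card {σ : Fin n → Projectivization F (Fin (k + 1) → F) // IsCap σ}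

/-- A planar space with (finite) point set `P`. -/
structure PlanarSpace (P : Type*) where
  lines : Finset (Finset P)
  planes : Finset (Finset P)
  existsUnique_line : ∀ a b : P, a ≠ b → ∃! L, L ∈ lines ∧ a ∈ L ∧ b ∈ L
  two_le_card_line : ∀ L ∈ lines, 2 ≤ L.card
  existsUnique_plane : ∀ a b c : P, a ≠ b → a ≠ c → b ≠ c →
    (¬ ∃ L ∈ lines, a ∈ L ∧ b ∈ L ∧ c ∈ L) →
    ∃! H, H ∈ planes ∧ a ∈ H ∧ b ∈ H ∧ c ∈ H

namespace PlanarSpace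

/-- The lines with at least three points. -/
def fullLines {P : Type*} (f : PlanarSpace P) : Finset (Finset P) :=
  f.lines.filter (fun L => 3 ≤ L.card)

/-- The planes with at least four points. -/
def fullPlanes {P : Type*} (f : PlanarSpace P) : Finset (Finset P) :=
  f.planes.filter (fun H => 4 ≤ H.card)

/-- Every point has index `(i, j)` with `i ≥ 4`, or `j ≥ 3`, or `(i, j) = (3, 0)`, where `i` and `j`
are the numbers of full planes and of full lines through the point. -/
def IsHyperfiguration {P : Type*} [DecidableEq P] (f : PlanarSpace P) : Prop :=
  ∀ p : P,
    4 ≤ (f.fullPlanes.filter (fun H => p ∈ H)).card ∨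
    3 ≤ (f.fullLines.filter (fun L => p ∈ L)).card ∨
    ((f.fullPlanes.filter (fun H => p ∈ H)).card = 3 ∧
      (f.fullLines.filter (fun L => p ∈ L)).card = 0)

/-- A strong realization of `f` in `ℙ³(F)`: an injective map such that a set of points of `f` is
sent into a line (into a plane) of `ℙ³(F)` if and only if it is contained in a line (in a plane)
of `f`. -/
def IsStrongRealization {P F : Type*} [Field F] (f : PlanarSpace P)
    (σ : P → Projectivization F (Fin 4 → F)) : Prop :=
  Function.Injective σ ∧
    (∀ S : Finset P, LieOnLine (σ '' (S : Set P)) ↔ ∃ L ∈ f.lines, S ⊆ L) ∧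
    (∀ S : Finset P, LieOnPlane (σ '' (S : Set P)) ↔ ∃ H ∈ f.planes, S ⊆ H)

/-- `A_f(4, q)` for `q = |F|`: the number of strong realizations of `f` in `ℙ³(F)`. -/
noncomputable def realizationCount {P : Type*} (f : PlanarSpace P) (F : Type*) [Field F] : ℕ :=
  Nat.card {σ : P → Projectivization F (Fin 4 → F) // f.IsStrongRealization σ}

/-- The planar space with prescribed full lines `𝓛` and full planes `𝓗`: its other lines are the
pairs of points on no member of `𝓛`, and its other planes are the triples of points that are
contained in no member of `𝓛` and in no member of `𝓗`. -/
def ofFull {P : Type*} [Fintype P] [DecidableEq P] (𝓛 𝓗 : Finset (Finset P))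
    (h𝓛 : ∀ L ∈ 𝓛, 3 ≤ L.card)
    (h𝓛𝓛 : ∀ L ∈ 𝓛, ∀ M ∈ 𝓛, L ≠ M → (L ∩ M).card ≤ 1)
    (h𝓗𝓗 : ∀ H ∈ 𝓗, ∀ K ∈ 𝓗, H ≠ K → (H ∩ K).card ≤ 2 ∨ ∃ L ∈ 𝓛, H ∩ K ⊆ L) :
    PlanarSpace P where
  lines := 𝓛 ∪ (Finset.univ.powersetCard 2).filter (fun S => ∀ L ∈ 𝓛, ¬ S ⊆ L)
  planes := 𝓗 ∪ (Finset.univ.powersetCard 3).filter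
    (fun S => (∀ L ∈ 𝓛, ¬ S ⊆ L) ∧ ∀ H ∈ 𝓗, ¬ S ⊆ H)
  existsUnique_line := by
    intro a b hab
    have hpair : ∀ S : Finset P, S.card = 2 → a ∈ S → b ∈ S → S = {a, b} := by
      intro S hS ha hb
      symm
      apply Finset.eq_of_subset_of_card_le
      · intro x hx
        simp only [Finset.mem_insert, Finset.mem_singleton] at hx
        rcases hx with rfl | rfl <;> assumption
      · rw [hS, Finset.card_pair hab]
    by_cases h : ∃ L ∈ 𝓛, a ∈ L ∧ b ∈ L
    · obtain ⟨L, hL, ha, hb⟩ := h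
      refine ⟨L, ⟨Finset.mem_union_left _ hL, ha, hb⟩, ?_⟩
      rintro M ⟨hM, ha', hb'⟩
      rcases Finset.mem_union.1 hM with hM | hM
      · by_contra hne
        have h1 := h𝓛𝓛 M hM L hL hne
        exact hab (Finset.card_le_one.1 h1 a (Finset.mem_inter.2 ⟨ha', ha⟩) b
          (Finset.mem_inter.2 ⟨hb', hb⟩))
      · simp only [Finset.mem_filter, Finset.mem_powersetCard] at hM
        have h2 := hpair M hM.1.2 ha' hb'
        exact absurd (by rw [h2]; simp [Finset.insert_subset_iff, ha, hb]) (hM.2 L hL)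
    · refine ⟨{a, b}, ⟨Finset.mem_union_right _ ?_, by simp, by simp⟩, ?_⟩
      · simp only [Finset.mem_filter, Finset.mem_powersetCard]
        refine ⟨⟨Finset.subset_univ _, Finset.card_pair hab⟩, fun L hL hs => h ⟨L, hL, ?_, ?_⟩⟩
        · exact hs (by simp)
        · exact hs (by simp)
      · rintro M ⟨hM, ha', hb'⟩
        rcases Finset.mem_union.1 hM with hM | hM
        · exact absurd ⟨M, hM, ha', hb'⟩ h
        · simp only [Finset.mem_filter, Finset.mem_powersetCard] at hM
          exact hpair M hM.1.2 ha' hb'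
  two_le_card_line := by
    intro L hL
    rcases Finset.mem_union.1 hL with hL | hL
    · exact (h𝓛 L hL).trans' (by norm_num)
    · simp only [Finset.mem_filter, Finset.mem_powersetCard] at hL
      exact hL.1.2.ge
  existsUnique_plane := by
    intro a b c hab hac hbc hn
    have hcard : ({a, b, c} : Finset P).card = 3 := Finset.card_eq_three.2 ⟨a, b, c, hab, hac, hbc, rfl⟩
    have hsub : ∀ S : Finset P, a ∈ S → b ∈ S → c ∈ S → ({a, b, c} : Finset P) ⊆ S := by
      intro S ha hb hc
      simp [Finset.insert_subset_iff, ha, hb, hc]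
    have htriple : ∀ S : Finset P, S.card = 3 → a ∈ S → b ∈ S → c ∈ S → S = {a, b, c} := by
      intro S hS ha hb hc
      exact (Finset.eq_of_subset_of_card_le (hsub S ha hb hc) (by rw [hS, hcard])).symm
    have hn' : ∀ L ∈ 𝓛, ¬ ({a, b, c} : Finset P) ⊆ L := fun L hL hs =>
      hn ⟨L, Finset.mem_union_left _ hL, hs (by simp), hs (by simp), hs (by simp)⟩
    by_cases h : ∃ H ∈ 𝓗, a ∈ H ∧ b ∈ H ∧ c ∈ H
    · obtain ⟨H, hH, ha, hb, hc⟩ := h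
      refine ⟨H, ⟨Finset.mem_union_left _ hH, ha, hb, hc⟩, ?_⟩
      rintro K ⟨hK, ha', hb', hc'⟩
      rcases Finset.mem_union.1 hK with hK | hK
      · by_contra hne
        have hs : ({a, b, c} : Finset P) ⊆ K ∩ H :=
          hsub _ (by simp [ha, ha']) (by simp [hb, hb']) (by simp [hc, hc'])
        rcases h𝓗𝓗 K hK H hH hne with h1 | ⟨L, hL, h1⟩
        · have := Finset.card_le_card hs
          omega
        · exact hn' L hL (hs.trans h1)
      · simp only [Finset.mem_filter, Finset.mem_powersetCard] at hK
        have h2 := htriple K hK.1.2 ha' hb' hc'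
        exact absurd (by rw [h2]; exact hsub H ha hb hc) (hK.2.2 H hH)
    · refine ⟨{a, b, c}, ⟨Finset.mem_union_right _ ?_, by simp, by simp, by simp⟩, ?_⟩
      · simp only [Finset.mem_filter, Finset.mem_powersetCard]
        refine ⟨⟨Finset.subset_univ _, hcard⟩, hn', fun H hH hs => h ⟨H, hH, ?_, ?_, ?_⟩⟩ <;>
          exact hs (by simp)
      · rintro K ⟨hK, ha', hb', hc'⟩
        rcases Finset.mem_union.1 hK with hK | hK
        · exact absurd ⟨K, hK, ha', hb', hc'⟩ h
        · simp only [Finset.mem_filter, Finset.mem_powersetCard] at hK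
          exact htriple K hK.1.2 ha' hb' hc'

/-- The hyperfiguration on 6 points (two skew lines with three points each). -/
def hyp6 : PlanarSpace (Fin 6) :=
  ofFull {{0, 1, 2}, {3, 4, 5}}
    {{0, 1, 2, 3}, {0, 1, 2, 4}, {0, 1, 2, 5}, {0, 3, 4, 5}, {1, 3, 4, 5}, {2, 3, 4, 5}}
    (by decide +kernel) (by decide +kernel) (by decide +kernel)

/-- The hyperfiguration `h₅` on 7 points (skew lines with four and with three points). -/
def h5 : PlanarSpace (Fin 7) :=
  ofFull {{0, 1, 2, 3}, {4, 5, 6}}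
    {{0, 1, 2, 3, 4}, {0, 1, 2, 3, 5}, {0, 1, 2, 3, 6}, {0, 4, 5, 6}, {1, 4, 5, 6}, {2, 4, 5, 6},
      {3, 4, 5, 6}}
    (by decide +kernel) (by decide +kernel) (by decide +kernel)

/-- The hyperfiguration `h₆` on 7 points (a Fano plane). -/
def h6 : PlanarSpace (Fin 7) :=
  ofFull {{0, 1, 2}, {0, 3, 4}, {0, 5, 6}, {1, 3, 5}, {1, 4, 6}, {2, 3, 6}, {2, 4, 5}}
    {{0, 1, 2, 3, 4, 5, 6}}
    (by decide +kernel) (by decide +kernel) (by decide +kernel)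

theorem fullLines_ofFull {P : Type*} [Fintype P] [DecidableEq P] (𝓛 𝓗 : Finset (Finset P))
    (h𝓛 : ∀ L ∈ 𝓛, 3 ≤ L.card)
    (h𝓛𝓛 : ∀ L ∈ 𝓛, ∀ M ∈ 𝓛, L ≠ M → (L ∩ M).card ≤ 1)
    (h𝓗𝓗 : ∀ H ∈ 𝓗, ∀ K ∈ 𝓗, H ≠ K → (H ∩ K).card ≤ 2 ∨ ∃ L ∈ 𝓛, H ∩ K ⊆ L) :
    (ofFull 𝓛 𝓗 h𝓛 h𝓛𝓛 h𝓗𝓗).fullLines = 𝓛 := by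
  ext L
  simp only [fullLines, ofFull, Finset.mem_filter, Finset.mem_union, Finset.mem_powersetCard]
  constructor
  · rintro ⟨h | h, h3⟩
    · exact h
    · omega
  · exact fun h => ⟨Or.inl h, h𝓛 L h⟩

theorem fullPlanes_ofFull {P : Type*} [Fintype P] [DecidableEq P] (𝓛 𝓗 : Finset (Finset P))
    (h𝓛 : ∀ L ∈ 𝓛, 3 ≤ L.card)
    (h𝓛𝓛 : ∀ L ∈ 𝓛, ∀ M ∈ 𝓛, L ≠ M → (L ∩ M).card ≤ 1)
    (h𝓗𝓗 : ∀ H ∈ 𝓗, ∀ K ∈ 𝓗, H ≠ K → (H ∩ K).card ≤ 2 ∨ ∃ L ∈ 𝓛, H ∩ K ⊆ L)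
    (h𝓗 : ∀ H ∈ 𝓗, 4 ≤ H.card) :
    (ofFull 𝓛 𝓗 h𝓛 h𝓛𝓛 h𝓗𝓗).fullPlanes = 𝓗 := by
  ext H
  simp only [fullPlanes, ofFull, Finset.mem_filter, Finset.mem_union, Finset.mem_powersetCard]
  constructor
  · rintro ⟨h | h, h3⟩
    · exact h
    · omega
  · exact fun h => ⟨Or.inl h, h𝓗 H h⟩

theorem isHyperfiguration_hyp6 : hyp6.IsHyperfiguration := by
  unfold IsHyperfiguration hyp6
  rw [fullLines_ofFull, fullPlanes_ofFull _ _ _ _ _ (by decide +kernel)]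
  decide +kernel

theorem isHyperfiguration_h5 : h5.IsHyperfiguration := by
  unfold IsHyperfiguration h5
  rw [fullLines_ofFull, fullPlanes_ofFull _ _ _ _ _ (by decide +kernel)]
  decide +kernel

theorem isHyperfiguration_h6 : h6.IsHyperfiguration := by
  unfold IsHyperfiguration h6
  rw [fullLines_ofFull, fullPlanes_ofFull _ _ _ _ _ (by decide +kernel)]
  decide +kernel

end PlanarSpace

section Matching

open Classical Finset

/-- A symmetric irreflexive relation in which every element has at most one partner. -/
structure IsMatchingRel {α : Type*} (R : α → α → Prop) : Prop where
  symm : ∀ a b, R a b → R b a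
  irrefl : ∀ a, ¬ R a a
  unique : ∀ a b c, R a b → R a c → b = c

namespace IsMatchingRel

variable {α : Type*} {R : α → α → Prop}

theorem exists_partner (h : IsMatchingRel R) :
    ∃ τ : α → α, ∀ a, (∃ b, R a b) → R a (τ a) ∧ ∀ b, R a b ↔ b = τ a := by
  refine ⟨fun a => if ha : ∃ b, R a b then ha.choose else a, fun a ha => ?_⟩
  simp only [dif_pos ha]
  exact ⟨ha.choose_spec, fun b => ⟨fun hb => h.unique _ _ _ hb ha.choose_spec,
    fun hb => hb ▸ ha.choose_spec⟩⟩

variable [Fintype α]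

theorem even_card (h : IsMatchingRel R) : Even (univ.filter fun a => ∃ b, R a b).card := by
  obtain ⟨τ, hτ⟩ := h.exists_partner
  have key : ∑ a ∈ univ.filter (fun a => ∃ b, R a b), (1 : ZMod 2) = 0 := by
    refine Finset.sum_involution (fun a _ => τ a) ?_ ?_ ?_ ?_
    · intro a _; decide
    · intro a ha _ h1
      have := (hτ a (by simpa using ha)).1
      rw [h1] at this
      exact h.irrefl _ this
    · intro a ha
      have := (hτ a (by simpa using ha)).1
      simpa using ⟨a, h.symm _ _ this⟩
    · intro a ha
      have h1 := (hτ a (by simpa using ha)).1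
      have h2 := h.symm _ _ h1
      exact (((hτ (τ a) ⟨a, h2⟩).2 a).1 h2).symm
  rw [Finset.sum_const, nsmul_one] at key
  exact (ZMod.natCast_eq_zero_iff_even).1 key

theorem card_pairs (h : IsMatchingRel R) :
    (univ.filter fun t : Fin 2 ↪ α => R (t 0) (t 1)).card =
      (univ.filter fun a => ∃ b, R a b).card := by
  refine Finset.card_bij (fun t _ => t 0) ?_ ?_ ?_
  · intro t ht
    simpa using ⟨t 1, by simpa using ht⟩
  · intro t ht t' ht' h0
    simp only [mem_filter, mem_univ, true_and] at ht ht'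
    ext i
    fin_cases i
    · exact h0
    · rw [← show t 0 = t' 0 from h0] at ht'
      exact h.unique _ _ _ ht ht'
  · intro a ha
    obtain ⟨b, hb⟩ : ∃ b, R a b := by simpa using ha
    have hab : a ≠ b := fun e => h.irrefl a (by rw [← e] at hb; exact hb)
    refine ⟨⟨![a, b], ?_⟩, ?_, rfl⟩
    · intro i j hij
      fin_cases i <;> fin_cases j <;> simp_all
    · exact mem_filter.2 ⟨mem_univ _, hb⟩

theorem card_quads (h : IsMatchingRel R) :
    ((univ.filter fun t : Fin 4 ↪ α => R (t 0) (t 1) ∧ R (t 2) (t 3)).card : ℤ) =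
      (univ.filter fun a => ∃ b, R a b).card * ((univ.filter fun a => ∃ b, R a b).card - 2) := by
  obtain ⟨τ, hτ⟩ := h.exists_partner
  set T := univ.filter fun a => ∃ b, R a b with hT
  have hTm : ∀ {a}, a ∈ T ↔ ∃ b, R a b := by simp [hT]
  have key : (univ.filter fun t : Fin 4 ↪ α => R (t 0) (t 1) ∧ R (t 2) (t 3)).card =
      (T.sigma fun a => T \ {a, τ a}).card := by
    refine Finset.card_bij (fun t _ => ⟨t 0, t 2⟩) ?_ ?_ ?_
    · intro t ht
      simp only [mem_filter, mem_univ, true_and] at ht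
      have h1 := ((hτ (t 0) ⟨_, ht.1⟩).2 (t 1)).1 ht.1
      simp only [mem_sigma, mem_sdiff, hTm, mem_insert, mem_singleton, ← h1,
        t.injective.eq_iff]
      exact ⟨⟨_, ht.1⟩, ⟨_, ht.2⟩, by decide⟩
    · intro t ht t' ht' h0
      simp only [mem_filter, mem_univ, true_and] at ht ht'
      simp only [Sigma.mk.injEq, heq_eq_eq] at h0
      rw [← h0.1, ← h0.2] at ht'
      ext i
      fin_cases i
      · exact h0.1
      · exact h.unique _ _ _ ht.1 ht'.1
      · exact h0.2
      · exact h.unique _ _ _ ht.2 ht'.2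
    · rintro ⟨a, c⟩ hac
      simp only [mem_sigma, mem_sdiff, hTm, mem_insert, mem_singleton, not_or] at hac
      obtain ⟨ha, hc, hca, hcb⟩ := hac
      have h1 := (hτ a ha).1
      have h2 := (hτ c hc).1
      have n1 : a ≠ τ a := fun e => h.irrefl a (by rw [← e] at h1; exact h1)
      have n2 : c ≠ τ c := fun e => h.irrefl c (by rw [← e] at h2; exact h2)
      have n3 : τ a ≠ τ c := fun e => hca (h.unique (τ a) _ _ (by rw [e]; exact h.symm _ _ h2)
        (h.symm _ _ h1))
      have n4 : τ c ≠ a := fun e => hcb ((hτ a ha).2 c |>.1 (h.symm _ _ (by rw [e] at h2; exact h2)))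
      refine ⟨⟨![a, τ a, c, τ c], ?_⟩, ?_, rfl⟩
      · intro i j hij
        fin_cases i <;> fin_cases j <;> simp_all [eq_comm]
      · simpa using ⟨h1, h2⟩
  have hs : ∀ a ∈ T, (((T \ {a, τ a}).card : ℕ) : ℤ) = T.card - 2 := by
    intro a ha
    have h1 := (hτ a (hTm.1 ha)).1
    have n1 : a ≠ τ a := fun e => h.irrefl a (by rw [← e] at h1; exact h1)
    have hsub : ({a, τ a} : Finset α) ⊆ T := by
      intro x hx
      simp only [mem_insert, mem_singleton] at hx
      rcases hx with rfl | rfl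
      · exact ha
      · exact hTm.2 ⟨a, h.symm _ _ h1⟩
    rw [card_sdiff_of_subset hsub, Nat.cast_sub (card_le_card hsub), card_pair n1]
    rfl
  rw [key, card_sigma, Nat.cast_sum, Finset.sum_congr rfl hs, Finset.sum_const, nsmul_eq_mul]

theorem card_sexts (h : IsMatchingRel R) :
    ((univ.filter fun t : Fin 6 ↪ α => R (t 0) (t 1) ∧ R (t 2) (t 3) ∧ R (t 4) (t 5)).card : ℤ) =
      (univ.filter fun a => ∃ b, R a b).card * ((univ.filter fun a => ∃ b, R a b).card - 2) *
        ((univ.filter fun a => ∃ b, R a b).card - 4) := by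
  obtain ⟨τ, hτ⟩ := h.exists_partner
  set T := univ.filter fun a => ∃ b, R a b with hT
  have hTm : ∀ {a}, a ∈ T ↔ ∃ b, R a b := by simp [hT]
  have hne : ∀ a ∈ T, a ≠ τ a := by
    intro a ha e
    have h1 := (hτ a (hTm.1 ha)).1
    exact h.irrefl a (by rw [← e] at h1; exact h1)
  have hmem : ∀ a ∈ T, τ a ∈ T := fun a ha => hTm.2 ⟨a, h.symm _ _ (hτ a (hTm.1 ha)).1⟩
  have hinv : ∀ a ∈ T, τ (τ a) = a := fun a ha =>
    (((hτ _ (hTm.1 (hmem a ha))).2 a).1 (h.symm _ _ (hτ a (hTm.1 ha)).1)).symm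
  have key : (univ.filter fun t : Fin 6 ↪ α =>
      R (t 0) (t 1) ∧ R (t 2) (t 3) ∧ R (t 4) (t 5)).card =
      (T.sigma fun a => (T \ {a, τ a}).sigma fun c => T \ {a, τ a, c, τ c}).card := by
    refine Finset.card_bij (fun t _ => ⟨t 0, t 2, t 4⟩) ?_ ?_ ?_
    · intro t ht
      simp only [mem_filter, mem_univ, true_and] at ht
      have h1 := ((hτ (t 0) ⟨_, ht.1⟩).2 (t 1)).1 ht.1
      have h2 := ((hτ (t 2) ⟨_, ht.2.1⟩).2 (t 3)).1 ht.2.1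
      simp only [mem_sigma, mem_sdiff, hTm, mem_insert, mem_singleton, ← h1, ← h2,
        t.injective.eq_iff]
      exact ⟨⟨_, ht.1⟩, ⟨⟨_, ht.2.1⟩, by decide⟩, ⟨_, ht.2.2⟩, by decide⟩
    · intro t ht t' ht' h0
      simp only [mem_filter, mem_univ, true_and] at ht ht'
      simp only [Sigma.mk.injEq, heq_eq_eq] at h0
      rw [← h0.1, ← h0.2.1, ← h0.2.2] at ht'
      ext i
      fin_cases i
      · exact h0.1
      · exact h.unique _ _ _ ht.1 ht'.1
      · exact h0.2.1
      · exact h.unique _ _ _ ht.2.1 ht'.2.1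
      · exact h0.2.2
      · exact h.unique _ _ _ ht.2.2 ht'.2.2
    · rintro ⟨a, c, e⟩ hac
      simp only [mem_sigma, mem_sdiff, mem_insert, mem_singleton, not_or] at hac
      obtain ⟨ha, ⟨hc, hca, hcb⟩, he, hea, heb, hec, hed⟩ := hac
      have i1 := hinv a ha
      have i2 := hinv c hc
      have i3 := hinv e he
      have n1 := hne a ha
      have n2 := hne c hc
      have n3 := hne e he
      refine ⟨⟨![a, τ a, c, τ c, e, τ e], ?_⟩, ?_, rfl⟩
      · intro i j hij
        fin_cases i <;> fin_cases j <;> first | rfl | (exfalso; simp at hij; grind)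
      · simpa using ⟨(hτ a (hTm.1 ha)).1, (hτ c (hTm.1 hc)).1, (hτ e (hTm.1 he)).1⟩
  have hs : ∀ a ∈ T, (((T \ {a, τ a}).card : ℕ) : ℤ) = T.card - 2 := by
    intro a ha
    have hsub : ({a, τ a} : Finset α) ⊆ T := by
      intro x hx
      simp only [mem_insert, mem_singleton] at hx
      rcases hx with rfl | rfl
      · exact ha
      · exact hmem _ ha
    rw [card_sdiff_of_subset hsub, Nat.cast_sub (card_le_card hsub), card_pair (hne a ha)]
    rfl
  have hs2 : ∀ a ∈ T, ∀ c ∈ T \ {a, τ a},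
      (((T \ {a, τ a, c, τ c}).card : ℕ) : ℤ) = T.card - 4 := by
    intro a ha c hc
    simp only [mem_sdiff, mem_insert, mem_singleton, not_or] at hc
    obtain ⟨hc, hca, hcb⟩ := hc
    have i1 := hinv a ha
    have i2 := hinv c hc
    have hsub : ({a, τ a, c, τ c} : Finset α) ⊆ T := by
      intro x hx
      simp only [mem_insert, mem_singleton] at hx
      rcases hx with rfl | rfl | rfl | rfl
      · exact ha
      · exact hmem _ ha
      · exact hc
      · exact hmem _ hc
    have hcard : ({a, τ a, c, τ c} : Finset α).card = 4 := by
      have n1 := hne a ha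
      have n2 := hne c hc
      rw [card_insert_of_notMem, card_insert_of_notMem, card_insert_of_notMem, card_singleton]
      · simpa using n2
      · simp; grind
      · simp; grind
    rw [card_sdiff_of_subset hsub, Nat.cast_sub (card_le_card hsub), hcard]
    rfl
  rw [key, card_sigma, Nat.cast_sum]
  have hs3 : ∀ a ∈ T, ((((T \ {a, τ a}).sigma fun c => T \ {a, τ a, c, τ c}).card : ℕ) : ℤ) =
      (T.card - 2) * (T.card - 4) := by
    intro a ha
    rw [card_sigma, Nat.cast_sum, Finset.sum_congr rfl (hs2 a ha), Finset.sum_const, nsmul_eq_mul,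
      hs a ha]
  rw [Finset.sum_congr rfl hs3, Finset.sum_const, nsmul_eq_mul]
  ring

/-- Inclusion–exclusion for a matching on at most six elements. -/
theorem indicator_eq (h : IsMatchingRel R) (hα : Fintype.card α ≤ 6) :
    (48 * (if ∃ a b, R a b then 1 else 0) : ℤ) =
      24 * (univ.filter fun t : Fin 2 ↪ α => R (t 0) (t 1)).card -
      6 * (univ.filter fun t : Fin 4 ↪ α => R (t 0) (t 1) ∧ R (t 2) (t 3)).card +
      (univ.filter fun t : Fin 6 ↪ α => R (t 0) (t 1) ∧ R (t 2) (t 3) ∧ R (t 4) (t 5)).card := by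
  rw [h.card_pairs, h.card_quads, h.card_sexts]
  obtain ⟨k, hk⟩ := h.even_card
  have hle : (univ.filter fun a => ∃ b, R a b).card ≤ 6 := (card_le_univ _).trans hα
  by_cases he : ∃ a b, R a b
  · obtain ⟨a, b, hab⟩ := he
    have hpos : 0 < (univ.filter fun a => ∃ b, R a b).card :=
      card_pos.2 ⟨a, by simpa using ⟨b, hab⟩⟩
    rw [if_pos ⟨a, b, hab⟩, hk]
    have : k = 1 ∨ k = 2 ∨ k = 3 := by omega
    rcases this with rfl | rfl | rfl <;> norm_num
  · have h0 : (univ.filter fun a => ∃ b, R a b) = ∅ := by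
      apply Finset.filter_false_of_mem
      intro a _ hb
      exact he ⟨a, hb⟩
    rw [if_neg he, h0]
    norm_num

end IsMatchingRel

end Matching

section VectorCaps

open Classical Finset

variable {K V : Type*} [Field K] [AddCommGroup V] [Module K V]

theorem linearIndependent_triple_iff {a b c : V} :
    LinearIndependent K ![a, b, c] ↔
      ∀ x y z : K, x • a + y • b + z • c = 0 → x = 0 ∧ y = 0 ∧ z = 0 := by
  rw [Fintype.linearIndependent_iff]
  constructor
  · intro h x y z hxyz
    have := h ![x, y, z] (by simpa [Fin.sum_univ_three] using hxyz)
    exact ⟨this 0, this 1, this 2⟩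
  · intro h g hg
    rw [Fin.sum_univ_three] at hg
    obtain ⟨h0, h1, h2⟩ := h _ _ _ hg
    intro i
    fin_cases i <;> assumption

variable (K) in
/-- Any three vectors of the family are linearly independent. -/
def IsVecCap {ι : Type*} (v : ι → V) : Prop :=
  ∀ i j k : ι, i ≠ j → i ≠ k → j ≠ k → LinearIndependent K ![v i, v j, v k]

variable (K) in
/-- `w` represents a point of the line through `a` and `b` other than these two points. -/
def OnSecant (a b w : V) : Prop := ∃ x y : K, x ≠ 0 ∧ y ≠ 0 ∧ w = x • a + y • b

variable (K) in
/-- `w` is a nonzero multiple of `a`. -/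
def IsMultiple (a w : V) : Prop := ∃ c : K, c ≠ 0 ∧ w = c • a

variable (K) in
/-- `w` is zero or represents a point on a secant of the family. -/
def IsCovered {ι : Type*} (v : ι → V) (w : V) : Prop :=
  w = 0 ∨ (∃ i, IsMultiple K (v i) w) ∨ ∃ i j, i ≠ j ∧ OnSecant K (v i) (v j) w

theorem OnSecant.symm {a b w : V} (h : OnSecant K a b w) : OnSecant K b a w := by
  obtain ⟨x, y, hx, hy, rfl⟩ := h
  exact ⟨y, x, hy, hx, add_comm _ _⟩

theorem IsVecCap.triple {ι : Type*} {v : ι → V} (h : IsVecCap K v) {i j k : ι} (hij : i ≠ j)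
    (hik : i ≠ k) (hjk : j ≠ k) (x y z : K) (he : x • v i + y • v j + z • v k = 0) :
    x = 0 ∧ y = 0 ∧ z = 0 :=
  linearIndependent_triple_iff.1 (h i j k hij hik hjk) x y z he

theorem IsVecCap.comp {ι κ : Type*} {v : ι → V} (h : IsVecCap K v) {t : κ → ι}
    (ht : Function.Injective t) : IsVecCap K (v ∘ t) :=
  fun _ _ _ hij hik hjk => h _ _ _ (ht.ne hij) (ht.ne hik) (ht.ne hjk)

theorem isVecCap_comp_equiv {ι κ : Type*} {v : ι → V} (t : κ ≃ ι) :
    IsVecCap K (v ∘ t) ↔ IsVecCap K v := by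
  refine ⟨fun h => ?_, fun h => h.comp t.injective⟩
  have := h.comp t.symm.injective
  rwa [Function.comp_assoc, Equiv.self_comp_symm, Function.comp_id] at this

theorem exists_third {n : ℕ} (hn : 3 ≤ n) (i j : Fin n) : ∃ k, k ≠ i ∧ k ≠ j := by
  have : ({i, j} : Finset (Fin n)).card < (univ : Finset (Fin n)).card :=
    (card_le_two).trans_lt (by rw [card_univ, Fintype.card_fin]; omega)
  obtain ⟨k, _, hk⟩ := exists_mem_notMem_of_card_lt_card this
  simp only [mem_insert, mem_singleton, not_or] at hk
  exact ⟨k, hk⟩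

theorem IsVecCap.pair {n : ℕ} (hn : 3 ≤ n) {v : Fin n → V} (h : IsVecCap K v) {i j : Fin n}
    (hij : i ≠ j) (x y : K) (he : x • v i + y • v j = 0) : x = 0 ∧ y = 0 := by
  obtain ⟨k, hki, hkj⟩ := exists_third hn i j
  have := h.triple hij hki.symm hkj.symm x y 0 (by simpa using he)
  exact ⟨this.1, this.2.1⟩

theorem IsVecCap.ne_zero {n : ℕ} (hn : 3 ≤ n) {v : Fin n → V} (h : IsVecCap K v) (i : Fin n) :
    v i ≠ 0 := by
  intro h0
  obtain ⟨k, hk, _⟩ := exists_third hn i i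
  have := h.pair hn hk.symm 1 0 (by simp [h0])
  exact one_ne_zero this.1

theorem isVecCap_succ_iff {n : ℕ} (hn : 3 ≤ n) (u : Fin (n + 1) → V) :
    IsVecCap K u ↔ IsVecCap K (Fin.init u) ∧ ¬ IsCovered K (Fin.init u) (u (Fin.last n)) := by
  constructor
  · intro h
    have hc : IsVecCap K (Fin.init u) := h.comp (Fin.castSucc_injective n)
    refine ⟨hc, ?_⟩
    rintro (h0 | ⟨i, c, hc0, hi⟩ | ⟨i, j, hij, x, y, hx, hy, hw⟩)
    · exact h.ne_zero (by omega) _ h0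
    · have := h.pair (i := i.castSucc) (j := Fin.last n) (by omega) (Fin.castSucc_lt_last i).ne
        c (-1) (by rw [hi]; simp only [Fin.init]; module)
      exact hc0 this.1
    · have := h.triple (i := i.castSucc) (j := j.castSucc) (k := Fin.last n)
        (by simpa using hij) (Fin.castSucc_lt_last i).ne
        (Fin.castSucc_lt_last j).ne x y (-1) (by rw [hw]; simp only [Fin.init]; module)
      exact hx this.1
  · rintro ⟨hc, hw⟩
    have hlast : ∀ i j : Fin n, i ≠ j → ∀ x y z : K,
        x • u i.castSucc + y • u j.castSucc + z • u (Fin.last n) = 0 → x = 0 ∧ y = 0 ∧ z = 0 := by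
      intro i j hij x y z h
      by_cases hz : z = 0
      · subst hz
        have := hc.pair hn hij x y (by simpa [Fin.init] using h)
        exact ⟨this.1, this.2, rfl⟩
      exfalso
      have hu : u (Fin.last n) = (-x / z) • u i.castSucc + (-y / z) • u j.castSucc := by
        have : u (Fin.last n) = z⁻¹ • (z • u (Fin.last n)) := by rw [smul_smul, inv_mul_cancel₀ hz,
          one_smul]
        rw [this]
        linear_combination (norm := module) z⁻¹ • h
      by_cases hx : x = 0
      · by_cases hy : y = 0
        · exact hw (Or.inl (by simpa [hx, hy] using hu))
        · exact hw (Or.inr (Or.inl ⟨j, -y / z, div_ne_zero (neg_ne_zero.2 hy) hz,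
            by simpa [hx, Fin.init] using hu⟩))
      · by_cases hy : y = 0
        · exact hw (Or.inr (Or.inl ⟨i, -x / z, div_ne_zero (neg_ne_zero.2 hx) hz,
            by simpa [hy, Fin.init] using hu⟩))
        · exact hw (Or.inr (Or.inr ⟨i, j, hij, -x / z, -y / z, div_ne_zero (neg_ne_zero.2 hx) hz,
            div_ne_zero (neg_ne_zero.2 hy) hz, hu⟩))
    intro i j k hij hik hjk
    rw [linearIndependent_triple_iff]
    intro x y z h
    induction i using Fin.lastCases with
    | last =>
      induction j using Fin.lastCases with
      | last => exact absurd rfl hij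
      | cast j =>
        induction k using Fin.lastCases with
        | last => exact absurd rfl hik
        | cast k =>
          have := hlast j k (by simpa using hjk) y z x (by rw [← h]; abel)
          tauto
    | cast i =>
      induction j using Fin.lastCases with
      | last =>
        induction k using Fin.lastCases with
        | last => exact absurd rfl hjk
        | cast k =>
          have := hlast i k (by simpa using hik) x z y (by rw [← h]; abel)
          tauto
      | cast j =>
        induction k using Fin.lastCases with
        | last => exact hlast i j (by simpa using hij) x y z h
        | cast k =>
          exact hc.triple (i := i) (j := j) (k := k) (by simpa using hij)
            (by simpa using hik) (by simpa using hjk) x y z h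

theorem IsVecCap.isMatchingRel {n : ℕ} {v : Fin n → V} (h : IsVecCap K v) (w : V) :
    IsMatchingRel fun i j => i ≠ j ∧ OnSecant K (v i) (v j) w where
  symm _ _ hab := ⟨hab.1.symm, hab.2.symm⟩
  irrefl _ ha := ha.1 rfl
  unique := by
    rintro a b c ⟨hab, x, y, hx, hy, hw⟩ ⟨hac, x', y', hx', hy', hw'⟩
    by_contra hbc
    have := h.triple hab hac hbc (x - x') y (-y') (by
      linear_combination (norm := module) hw' - hw)
    exact hy this.2.1

theorem IsVecCap.indicator_isCovered {n : ℕ} (hn : 3 ≤ n) (hn6 : n ≤ 6) {v : Fin n → V}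
    (h : IsVecCap K v) (w : V) :
    (48 * (if IsCovered K v w then 1 else 0) : ℤ) =
      48 * (if w = 0 then 1 else 0) +
      48 * (univ.filter fun i : Fin n => IsMultiple K (v i) w).card +
      24 * (univ.filter fun t : Fin 2 ↪ Fin n => OnSecant K (v (t 0)) (v (t 1)) w).card -
      6 * (univ.filter fun t : Fin 4 ↪ Fin n => OnSecant K (v (t 0)) (v (t 1)) w ∧
        OnSecant K (v (t 2)) (v (t 3)) w).card +
      (univ.filter fun t : Fin 6 ↪ Fin n => OnSecant K (v (t 0)) (v (t 1)) w ∧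
        OnSecant K (v (t 2)) (v (t 3)) w ∧ OnSecant K (v (t 4)) (v (t 5)) w).card := by
  have key := (h.isMatchingRel w).indicator_eq (by simpa using hn6)
  simp only [Function.Embedding.injective _ |>.eq_iff, ne_eq, Fin.reduceEq,
    not_false_eq_true, true_and] at key
  by_cases hR : ∃ a b, ¬ a = b ∧ OnSecant K (v a) (v b) w
  · have hcov : IsCovered K v w := Or.inr (Or.inr hR)
    obtain ⟨i, j, hij, x, y, hx, hy, hw⟩ := hR
    have h0 : w ≠ 0 := fun h0 => hx (h.pair hn hij x y (by rw [← hw, h0])).1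
    have h1 : (univ.filter fun i : Fin n => IsMultiple K (v i) w) = ∅ := by
      apply filter_false_of_mem
      rintro k - ⟨c, hc, hk⟩
      by_cases hki : k = i
      · subst hki
        exact hy (h.pair hn hij (x - c) y (by linear_combination (norm := module) hk - hw)).2
      by_cases hkj : k = j
      · subst hkj
        exact hx (h.pair hn hij x (y - c) (by linear_combination (norm := module) hk - hw)).1
      exact hx (h.triple hij (Ne.symm hki) (Ne.symm hkj) x y (-c)
        (by linear_combination (norm := module) hk - hw)).1
    rw [if_pos hcov, if_neg h0, h1]
    rw [if_pos ⟨i, j, hij, x, y, hx, hy, hw⟩] at key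
    simp only [card_empty, Nat.cast_zero]
    linarith
  · rw [if_neg hR] at key
    have hgoal : (48 * (if IsCovered K v w then 1 else 0) : ℤ) =
      48 * (if w = 0 then 1 else 0) +
      48 * (univ.filter fun i : Fin n => IsMultiple K (v i) w).card := by
      by_cases h0 : w = 0
      · have h1 : (univ.filter fun i : Fin n => IsMultiple K (v i) w) = ∅ := by
          apply filter_false_of_mem
          rintro k - ⟨c, hc, hk⟩
          rw [h0] at hk
          exact (smul_ne_zero hc (h.ne_zero hn k)) hk.symm
        rw [if_pos (show IsCovered K v w from Or.inl h0), if_pos h0, h1]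
        simp
      · rw [if_neg h0]
        by_cases hp : ∃ i, IsMultiple K (v i) w
        · have hcov : IsCovered K v w := Or.inr (Or.inl hp)
          obtain ⟨i, c, hc, hw⟩ := hp
          have h1 : (univ.filter fun i : Fin n => IsMultiple K (v i) w) = {i} := by
            ext k
            simp only [mem_filter, mem_univ, true_and, mem_singleton]
            constructor
            · rintro ⟨c', hc', hk⟩
              by_contra hki
              exact hc' (h.pair hn hki c' (-c) (by linear_combination (norm := module) hw - hk)).1
            · rintro rfl
              exact ⟨c, hc, hw⟩
          rw [if_pos hcov, h1]
          simp
        · have hcov : ¬ IsCovered K v w := by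
            rintro (h1 | h1 | h1)
            · exact h0 h1
            · exact hp h1
            · exact hR h1
          have h1 : (univ.filter fun i : Fin n => IsMultiple K (v i) w) = ∅ := by
            apply filter_false_of_mem
            rintro k - hk
            exact hp ⟨k, hk⟩
          rw [if_neg hcov, h1]
          simp
    linarith

theorem IsVecCap.coeff_ne_zero {n : ℕ} {v : Fin n → V} (h : IsVecCap K v) (t : Fin 4 ↪ Fin n)
    {g : Fin 4 → K} (hg : ∑ i, g i • v (t i) = 0) (hg0 : g ≠ 0) (i : Fin 4) : g i ≠ 0 := by
  intro hi
  apply hg0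
  rw [Fin.sum_univ_four] at hg
  have ne : ∀ {i j : Fin 4}, i ≠ j → t i ≠ t j := fun hij => t.injective.ne hij
  funext j
  fin_cases i
  · change g 0 = 0 at hi
    rw [hi, zero_smul, zero_add] at hg
    have := h.triple (ne (by decide)) (ne (by decide)) (ne (by decide)) _ _ _ hg
    fin_cases j
    exacts [hi, this.1, this.2.1, this.2.2]
  · change g 1 = 0 at hi
    rw [hi, zero_smul, add_zero] at hg
    have := h.triple (ne (by decide)) (ne (by decide)) (ne (by decide)) _ _ _ hg
    fin_cases j
    exacts [this.1, hi, this.2.1, this.2.2]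
  · change g 2 = 0 at hi
    rw [hi, zero_smul, add_zero] at hg
    have := h.triple (ne (by decide)) (ne (by decide)) (ne (by decide)) _ _ _ hg
    fin_cases j
    exacts [this.1, this.2.1, hi, this.2.2]
  · change g 3 = 0 at hi
    rw [hi, zero_smul, add_zero] at hg
    have := h.triple (ne (by decide)) (ne (by decide)) (ne (by decide)) _ _ _ hg
    fin_cases j
    exacts [this.1, this.2.1, this.2.2, hi]

variable [Fintype K]

theorem card_filter_ne_zero :
    ((univ.filter fun x : K => x ≠ 0).card : ℤ) = Fintype.card K - 1 := by
  rw [filter_ne', card_erase_of_mem (mem_univ _), card_univ, Nat.cast_sub Fintype.card_pos,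
    Nat.cast_one]

variable [Fintype V]

theorem card_smul_ne_zero {a : V} (ha : a ≠ 0) :
    ((univ.filter fun w : V => IsMultiple K a w).card : ℤ) = Fintype.card K - 1 := by
  rw [← card_filter_ne_zero]
  congr 1
  symm
  refine Finset.card_bij (fun c _ => c • a) ?_ ?_ ?_
  · intro c hc
    simpa using ⟨c, by simpa using hc, rfl⟩
  · intro c _ d _ hcd
    exact smul_left_injective K ha hcd
  · intro w hw
    obtain ⟨c, hc, rfl⟩ : IsMultiple K a w := by simpa using hw
    exact ⟨c, by simpa using hc, rfl⟩

theorem card_onSecant {a b : V} (hab : ∀ x y : K, x • a + y • b = 0 → x = 0 ∧ y = 0) :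
    ((univ.filter fun w : V => OnSecant K a b w).card : ℤ) = (Fintype.card K - 1) ^ 2 := by
  rw [← card_filter_ne_zero, sq, ← Nat.cast_mul, ← card_product]
  congr 1
  symm
  refine Finset.card_bij (fun c _ => c.1 • a + c.2 • b) ?_ ?_ ?_
  · rintro ⟨x, y⟩ hc
    simp only [mem_product, mem_filter, mem_univ, true_and] at hc
    simpa using ⟨x, y, hc.1, hc.2, rfl⟩
  · rintro ⟨x, y⟩ _ ⟨x', y'⟩ _ hcd
    dsimp only at hcd
    have := hab (x - x') (y - y') (by linear_combination (norm := module) hcd)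
    rw [sub_eq_zero.1 this.1, sub_eq_zero.1 this.2]
  · intro w hw
    obtain ⟨x, y, hx, hy, rfl⟩ : OnSecant K a b w := by simpa using hw
    exact ⟨(x, y), by simpa using ⟨hx, hy⟩, rfl⟩

theorem IsVecCap.card_onSecant_inter {n : ℕ} (hn : 3 ≤ n) {v : Fin n → V} (h : IsVecCap K v)
    (t : Fin 4 ↪ Fin n) :
    ((univ.filter fun w : V => OnSecant K (v (t 0)) (v (t 1)) w ∧
        OnSecant K (v (t 2)) (v (t 3)) w).card : ℤ) =
      (Fintype.card K - 1) * (if LinearIndependent K (v ∘ t) then 0 else 1) := by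
  have ne : ∀ {i j : Fin 4}, i ≠ j → t i ≠ t j := fun hij => t.injective.ne hij
  split_ifs with hli
  · rw [mul_zero, Nat.cast_eq_zero, card_eq_zero]
    apply filter_false_of_mem
    rintro w - ⟨⟨x, y, hx, hy, hw⟩, ⟨x', y', hx', hy', hw'⟩⟩
    have := Fintype.linearIndependent_iff.1 hli ![x, y, -x', -y'] (by
      simp only [Fin.sum_univ_four, Function.comp]
      simp only [Matrix.cons_val]
      linear_combination (norm := module) hw' - hw)
    exact hx (this 0)
  · rw [mul_one, ← card_filter_ne_zero]
    rw [Fintype.linearIndependent_iff] at hli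
    push Not at hli
    obtain ⟨g, hg, j, hj⟩ := hli
    have hne := h.coeff_ne_zero t hg (fun h0 => hj (by rw [h0]; rfl))
    simp only [Fin.sum_univ_four, Function.comp] at hg
    congr 1
    symm
    refine Finset.card_bij (fun c _ => c • (g 0 • v (t 0) + g 1 • v (t 1))) ?_ ?_ ?_
    · intro c hc
      have hc : c ≠ 0 := by simpa using hc
      simp only [mem_filter, mem_univ, true_and]
      refine ⟨⟨c * g 0, c * g 1, mul_ne_zero hc (hne 0), mul_ne_zero hc (hne 1), by module⟩,
        ⟨-(c * g 2), -(c * g 3), neg_ne_zero.2 (mul_ne_zero hc (hne 2)),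
          neg_ne_zero.2 (mul_ne_zero hc (hne 3)), ?_⟩⟩
      linear_combination (norm := module) c • hg
    · intro c _ d _ hcd
      have := (h.pair hn (ne (show (0 : Fin 4) ≠ 1 by decide)) (c * g 0 - d * g 0)
        (c * g 1 - d * g 1) (by linear_combination (norm := module) hcd)).1
      rw [← sub_mul] at this
      exact sub_eq_zero.1 ((mul_eq_zero.1 this).resolve_right (hne 0))
    · intro w hw
      simp only [mem_filter, mem_univ, true_and] at hw
      obtain ⟨⟨x, y, hx, hy, hw⟩, ⟨x', y', hx', hy', hw'⟩⟩ := hw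
      have h3 := h.triple (ne (show (0 : Fin 4) ≠ 1 by decide)) (ne (show (0 : Fin 4) ≠ 2 by decide))
        (ne (show (1 : Fin 4) ≠ 2 by decide)) (x * g 3 + y' * g 0) (y * g 3 + y' * g 1)
        (-(x' * g 3) + y' * g 2) (by linear_combination (norm := module) g 3 • (hw' - hw) + y' • hg)
      refine ⟨-(y' / g 3), ?_, ?_⟩
      · simpa using ⟨hy', hne 3⟩
      · rw [hw]
        have e1 : x = -(y' / g 3) * g 0 := by
          have := hne 3
          field_simp
          linear_combination h3.1
        have e2 : y = -(y' / g 3) * g 1 := by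
          have := hne 3
          field_simp
          linear_combination h3.2.1
        rw [e1, e2]
        module

theorem sum_card_filter_comm {α β : Type*} [Fintype α] [Fintype β] (P : α → β → Prop)
    [∀ a b, Decidable (P a b)] :
    ∑ a, ((univ.filter fun b => P a b).card : ℤ) = ∑ b, ((univ.filter fun a => P a b).card : ℤ) := by
  simp only [card_filter, Nat.cast_sum]
  exact sum_comm

/-- The number of vectors covered by the secants of a cap with at most six points. -/
theorem IsVecCap.card_isCovered {n : ℕ} (hn : 3 ≤ n) (hn6 : n ≤ 6) {v : Fin n → V}
    (h : IsVecCap K v) :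
    (48 * (univ.filter fun w : V => IsCovered K v w).card : ℤ) =
      48 + 48 * (n * (Fintype.card K - 1)) + 24 * (n * (n - 1) * (Fintype.card K - 1) ^ 2) -
      6 * ((Fintype.card K - 1) *
        (univ.filter fun t : Fin 4 ↪ Fin n => ¬ LinearIndependent K (v ∘ t)).card) +
      ∑ t : Fin 6 ↪ Fin n, ((univ.filter fun w : V => OnSecant K (v (t 0)) (v (t 1)) w ∧
        OnSecant K (v (t 2)) (v (t 3)) w ∧ OnSecant K (v (t 4)) (v (t 5)) w).card : ℤ) := by
  have e0 : ((univ.filter fun w : V => IsCovered K v w).card : ℤ) =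
      ∑ w : V, if IsCovered K v w then 1 else 0 := by
    rw [card_filter, Nat.cast_sum]; simp
  rw [e0, mul_sum, sum_congr rfl fun w _ => h.indicator_isCovered hn hn6 w]
  simp only [sum_add_distrib, sum_sub_distrib, ← mul_sum]
  rw [sum_card_filter_comm fun (w : V) (i : Fin n) => IsMultiple K (v i) w,
    sum_card_filter_comm fun (w : V) (t : Fin 2 ↪ Fin n) => OnSecant K (v (t 0)) (v (t 1)) w,
    sum_card_filter_comm fun (w : V) (t : Fin 4 ↪ Fin n) => OnSecant K (v (t 0)) (v (t 1)) w ∧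
      OnSecant K (v (t 2)) (v (t 3)) w,
    sum_card_filter_comm fun (w : V) (t : Fin 6 ↪ Fin n) => OnSecant K (v (t 0)) (v (t 1)) w ∧
      OnSecant K (v (t 2)) (v (t 3)) w ∧ OnSecant K (v (t 4)) (v (t 5)) w]
  rw [sum_congr rfl fun i _ => card_smul_ne_zero (h.ne_zero hn i),
    sum_congr rfl fun (t : Fin 2 ↪ Fin n) _ =>
      card_onSecant (K := K) (a := v (t 0)) (b := v (t 1))
        (h.pair hn (t.injective.ne (by decide))),
    sum_congr rfl fun (t : Fin 4 ↪ Fin n) _ => h.card_onSecant_inter hn t]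
  have e1 : ∑ w : V, (if w = 0 then 1 else 0 : ℤ) = 1 := by simp
  have e2 : ∑ t : Fin 4 ↪ Fin n, (if LinearIndependent K (v ∘ t) then 0 else 1 : ℤ) =
      (univ.filter fun t : Fin 4 ↪ Fin n => ¬ LinearIndependent K (v ∘ t)).card := by
    rw [card_filter, Nat.cast_sum]
    exact sum_congr rfl fun t _ => by split_ifs <;> simp
  have e3 : (Fintype.card (Fin 2 ↪ Fin n) : ℤ) = n * (n - 1) := by
    rw [Fintype.card_embedding_eq, Fintype.card_fin, Fintype.card_fin]
    obtain ⟨m, rfl⟩ : ∃ m, n = m + 1 := ⟨n - 1, by omega⟩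
    simp [Nat.descFactorial_succ]
    ring
  rw [e1, ← mul_sum, e2, sum_const, sum_const, card_univ, card_univ, Fintype.card_fin, nsmul_eq_mul,
    nsmul_eq_mul, e3]
  ring

end VectorCaps

section CapCounts

open Classical Finset

variable {K V : Type*} [Field K] [AddCommGroup V] [Module K V]

theorem isVecCap_fin_three {v : Fin 3 → V} : IsVecCap K v ↔ LinearIndependent K v := by
  constructor
  · intro h
    have := h 0 1 2 (by decide) (by decide) (by decide)
    convert this using 1
    ext i
    fin_cases i <;> rfl
  · intro h i j k hij hik hjk
    have := h.comp ![i, j, k] (by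
      intro a b hab
      fin_cases a <;> fin_cases b <;> simp_all)
    convert this using 1
    ext a
    fin_cases a <;> rfl

theorem linearIndependent_succ_iff {n : ℕ} {u : Fin (n + 1) → V} :
    LinearIndependent K u ↔ LinearIndependent K (Fin.init u) ∧
      u (Fin.last n) ∉ Submodule.span K (Set.range (Fin.init u)) := by
  rw [← linearIndependent_finSnoc, Fin.snoc_init_self]

variable (K V) in
/-- The caps with `n + 4` vectors the first four of which are linearly dependent. -/
def IsDepCap {n : ℕ} (v : Fin (n + 4) → V) : Prop :=
  IsVecCap K v ∧ ¬ LinearIndependent K (fun i : Fin 4 => v (Fin.castLE (by omega) i))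

theorem isDepCap_succ_iff {n : ℕ} (u : Fin (n + 1 + 4) → V) :
    IsDepCap K V u ↔ IsDepCap K V (n := n) (Fin.init u) ∧
      ¬ IsCovered K (Fin.init u : Fin (n + 4) → V) (u (Fin.last (n + 4))) := by
  have h : IsVecCap K u ↔ IsVecCap K (Fin.init u : Fin (n + 4) → V) ∧
      ¬ IsCovered K (Fin.init u : Fin (n + 4) → V) (u (Fin.last (n + 4))) :=
    isVecCap_succ_iff (by omega) u
  unfold IsDepCap
  rw [h, and_right_comm]
  rfl

theorem isDepCap_zero_iff (u : Fin 4 → V) :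
    IsDepCap K V (n := 0) u ↔ IsVecCap K (Fin.init u : Fin 3 → V) ∧
      (u (Fin.last 3) ∈ Submodule.span K (Set.range (Fin.init u)) ∧
      ¬ IsCovered K (Fin.init u : Fin 3 → V) (u (Fin.last 3))) := by
  unfold IsDepCap
  rw [isVecCap_succ_iff le_rfl u]
  have e : (fun i : Fin 4 => u (Fin.castLE (by omega) i)) = u := rfl
  rw [e, linearIndependent_succ_iff (u := u), isVecCap_fin_three]
  tauto

theorem IsCovered.mem {ι : Type*} {v : ι → V} {w : V} (h : IsCovered K v w) (W : Submodule K V)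
    (hv : ∀ i, v i ∈ W) : w ∈ W := by
  rcases h with rfl | ⟨i, c, -, rfl⟩ | ⟨i, j, -, x, y, -, -, rfl⟩
  · exact W.zero_mem
  · exact W.smul_mem _ (hv i)
  · exact W.add_mem (W.smul_mem _ (hv i)) (W.smul_mem _ (hv j))

/-- The span of a dependent cap of four vectors is the span of the first three. -/
theorem IsDepCap.span_eq {v : Fin 4 → V} (h : IsDepCap K V (n := 0) v) :
    Submodule.span K (Set.range v) = Submodule.span K (Set.range (Fin.init v : Fin 3 → V)) := by
  have h' := ((isDepCap_zero_iff v).1 h).2.1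
  apply le_antisymm
  · rw [Submodule.span_le]
    rintro _ ⟨i, rfl⟩
    induction i using Fin.lastCases with
    | last => exact h'
    | cast i => exact Submodule.subset_span ⟨i, rfl⟩
  · apply Submodule.span_mono
    rintro _ ⟨i, rfl⟩
    exact ⟨i.castSucc, rfl⟩

theorem IsDepCap.not_linearIndependent_comp {v : Fin 4 → V} (h : IsDepCap K V (n := 0) v)
    (t : Fin 4 ↪ Fin 4) : ¬ LinearIndependent K (v ∘ t) := by
  have ht : Function.Bijective t := Finite.injective_iff_bijective.1 t.injective
  have := linearIndependent_equiv (R := K) (Equiv.ofBijective t ht) (f := v)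
  rw [Equiv.coe_ofBijective] at this
  rw [this]
  exact h.2

theorem IsDepCap.mem_span {v : Fin 5 → V} (h : IsDepCap K V (n := 1) v) (t : Fin 4 ↪ Fin 5)
    (ht : ∃ m, t m = Fin.last 4) (hd : ¬ LinearIndependent K (v ∘ t)) :
    v (Fin.last 4) ∈ Submodule.span K (Set.range (Fin.init v : Fin 4 → V)) := by
  obtain ⟨m, hm⟩ := ht
  rw [Fintype.linearIndependent_iff] at hd
  push Not at hd
  obtain ⟨g, hg, j, hj⟩ := hd
  have hne := h.1.coeff_ne_zero t hg (fun h0 => hj (by rw [h0]; rfl))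
  rw [← Finset.add_sum_erase _ _ (mem_univ m)] at hg
  have hmem : ∑ i ∈ univ.erase m, g i • (v ∘ t) i ∈
      Submodule.span K (Set.range (Fin.init v : Fin 4 → V)) := by
    refine Submodule.sum_mem _ fun i hi => Submodule.smul_mem _ _ (Submodule.subset_span ?_)
    have hne : t i ≠ Fin.last 4 := by
      rw [← hm]
      exact t.injective.ne (ne_of_mem_erase hi)
    obtain ⟨k, hk⟩ := Fin.exists_castSucc_eq.2 hne
    exact ⟨k, by simp [Fin.init, hk]⟩
  have h1 : g m • v (Fin.last 4) ∈ Submodule.span K (Set.range (Fin.init v : Fin 4 → V)) := by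
    rw [Function.comp, hm] at hg
    rw [eq_neg_of_add_eq_zero_left hg]
    exact Submodule.neg_mem _ hmem
  exact (Submodule.smul_mem_iff _ (hne m)).1 h1

theorem card_embedding_ne_last :
    (univ.filter fun t : Fin 4 ↪ Fin 5 => ¬ ∃ m, t m = Fin.last 4).card = 24 := by
  have : (univ.filter fun t : Fin 4 ↪ Fin 5 => ¬ ∃ m, t m = Fin.last 4) =
      univ.image fun t : Fin 4 ↪ Fin 4 => t.trans Fin.castSuccEmb := by
    ext t
    simp only [mem_filter, mem_univ, true_and, not_exists, mem_image]
    constructor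
    · intro h
      choose f hf using fun m => Fin.exists_castSucc_eq.2 (h m)
      refine ⟨⟨f, fun a b hab => t.injective ?_⟩, ?_⟩
      · rw [← hf, ← hf, hab]
      · ext m
        exact congrArg Fin.val (hf m)
    · rintro ⟨s, rfl⟩ m
      exact (Fin.castSucc_lt_last _).ne
  rw [this, card_image_of_injective, card_univ, Fintype.card_embedding_eq]
  · simp [Nat.descFactorial]
  · intro s t hst
    ext m
    have := DFunLike.congr_fun hst m
    exact congrArg Fin.val (Fin.castSucc_injective _ this)

theorem IsDepCap.card_dependent {v : Fin 5 → V} (h : IsDepCap K V (n := 1) v) :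
    ((univ.filter fun t : Fin 4 ↪ Fin 5 => ¬ LinearIndependent K (v ∘ t)).card : ℤ) =
      24 + 96 * (if v (Fin.last 4) ∈ Submodule.span K (Set.range (Fin.init v : Fin 4 → V))
        then 1 else 0) := by
  have h' := (isDepCap_succ_iff (n := 0) v).1 h
  have hinit : ∀ t : Fin 4 ↪ Fin 5, (¬ ∃ m, t m = Fin.last 4) →
      ¬ LinearIndependent K (v ∘ t) := by
    intro t ht
    push Not at ht
    choose f hf using fun m => Fin.exists_castSucc_eq.2 (ht m)
    have := h'.1.not_linearIndependent_comp ⟨f, fun a b hab => t.injective (by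
      rw [← hf, ← hf, hab])⟩
    convert this using 2
    ext m
    exact congrArg v (hf m).symm
  split_ifs with hs
  · have hall : (univ.filter fun t : Fin 4 ↪ Fin 5 => ¬ LinearIndependent K (v ∘ t)) = univ := by
      apply filter_true_of_mem
      intro t _ hli
      have hmem : ∀ i, v i ∈
          Submodule.span K (Set.range (Fin.init (Fin.init v : Fin 4 → V) : Fin 3 → V)) := by
        rw [← h'.1.span_eq]
        intro i
        induction i using Fin.lastCases with
        | last => exact hs
        | cast i => exact Submodule.subset_span ⟨i, rfl⟩
      have h1 : Submodule.span K (Set.range (v ∘ t)) ≤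
          Submodule.span K (Set.range (Fin.init (Fin.init v : Fin 4 → V) : Fin 3 → V)) := by
        rw [Submodule.span_le]
        rintro _ ⟨i, rfl⟩
        exact hmem _
      have h2 := finrank_span_eq_card hli
      have h3 := finrank_range_le_card (R := K) (Fin.init (Fin.init v : Fin 4 → V) : Fin 3 → V)
      have := FiniteDimensional.span_of_finite K
        (Set.finite_range (Fin.init (Fin.init v : Fin 4 → V) : Fin 3 → V))
      have h4 := Submodule.finrank_mono h1
      rw [Set.finrank] at h3
      simp only [Fintype.card_fin] at h2 h3
      omega
    rw [hall, card_univ, Fintype.card_embedding_eq]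
    simp [Nat.descFactorial]
  · have hiff : (univ.filter fun t : Fin 4 ↪ Fin 5 => ¬ LinearIndependent K (v ∘ t)) =
        univ.filter fun t : Fin 4 ↪ Fin 5 => ¬ ∃ m, t m = Fin.last 4 := by
      apply filter_congr
      intro t _
      exact ⟨fun hd ht => hs (h.mem_span t ht hd), hinit t⟩
    rw [hiff, card_embedding_ne_last]
    norm_num

theorem card_fin_succ {α : Type*} [Fintype α] {n : ℕ} {S : (Fin (n + 1) → α) → Prop}
    (P : (Fin n → α) → Prop) (G : (Fin n → α) → α → Prop) [DecidablePred S] [DecidablePred P]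
    [∀ v, DecidablePred (G v)] (h : ∀ u, S u ↔ P (Fin.init u) ∧ G (Fin.init u) (u (Fin.last n))) :
    (univ.filter S).card = ∑ v ∈ univ.filter P, (univ.filter (G v)).card := by
  rw [← card_sigma]
  refine Finset.card_bij (fun u _ => ⟨Fin.init u, u (Fin.last n)⟩) ?_ ?_ ?_
  · intro u hu
    rw [mem_filter, h] at hu
    simpa using hu
  · intro u _ u' _ h'
    simp only [Sigma.mk.injEq, heq_eq_eq] at h'
    rw [← Fin.snoc_init_self u, ← Fin.snoc_init_self u', h'.1, h'.2]
  · rintro ⟨v, w⟩ h'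
    refine ⟨Fin.snoc v w, ?_, ?_⟩
    · rw [mem_filter, h]
      simpa using h'
    · simp

variable [Fintype V]

theorem card_not_isCovered {ι : Type*} (v : ι → V) (W : Submodule K V) (hv : ∀ i, v i ∈ W) :
    ((univ.filter fun w : V => w ∈ W ∧ ¬ IsCovered K v w).card : ℤ) =
      Nat.card W - (univ.filter fun w : V => IsCovered K v w).card := by
  have h1 : Nat.card W = (univ.filter fun w : V => w ∈ W).card := by
    rw [Nat.card_eq_fintype_card, ← Fintype.card_subtype]
  have h2 := card_filter_add_card_filter_not (s := univ.filter fun w : V => w ∈ W)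
    (fun w => IsCovered K v w)
  rw [filter_filter, filter_filter] at h2
  have h3 : (univ.filter fun w : V => w ∈ W ∧ IsCovered K v w) =
      univ.filter fun w : V => IsCovered K v w := by
    apply filter_congr
    intro w _
    exact ⟨fun h => h.2, fun h => ⟨h.mem W hv, h⟩⟩
  rw [h3] at h2
  rw [h1, ← h2]
  push_cast
  ring

theorem card_not_isCovered' {ι : Type*} (v : ι → V) :
    ((univ.filter fun w : V => ¬ IsCovered K v w).card : ℤ) =
      Fintype.card V - (univ.filter fun w : V => IsCovered K v w).card := by
  have := card_filter_add_card_filter_not (s := (univ : Finset V)) (fun w => IsCovered K v w)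
  rw [card_univ] at this
  rw [← this]
  push_cast
  ring

/-- Summing over all caps, every choice of indices contributes equally. -/
theorem sum_isVecCap_embedding {n k : ℕ} (f : (Fin k → V) → ℤ) (t₀ : Fin k ↪ Fin n) :
    ∑ v ∈ univ.filter (fun v : Fin n → V => IsVecCap K v), ∑ t : Fin k ↪ Fin n, f (v ∘ t) =
      n.descFactorial k * ∑ v ∈ univ.filter (fun v : Fin n → V => IsVecCap K v), f (v ∘ t₀) := by
  rw [sum_comm]
  have : ∀ t : Fin k ↪ Fin n, ∑ v ∈ univ.filter (fun v : Fin n → V => IsVecCap K v), f (v ∘ t) =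
      ∑ v ∈ univ.filter (fun v : Fin n → V => IsVecCap K v), f (v ∘ t₀) := by
    intro t
    obtain ⟨σ, hσ⟩ := Equiv.Perm.exists_extending_pair t₀ t t₀.injective t.injective
    refine Finset.sum_bij (fun v _ => v ∘ σ) ?_ ?_ ?_ ?_
    · intro v hv
      simpa [isVecCap_comp_equiv] using hv
    · intro v _ v' _ h
      exact σ.surjective.injective_comp_right h
    · intro v hv
      refine ⟨v ∘ σ.symm, ?_, ?_⟩
      · simpa [isVecCap_comp_equiv] using hv
      · simp [Function.comp_assoc]
    · intro v _
      congr 1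
      funext i
      simp [hσ]
  rw [sum_congr rfl fun t _ => this t, sum_const, card_univ, Fintype.card_embedding_eq,
    nsmul_eq_mul, Fintype.card_fin, Fintype.card_fin]

end CapCounts

section CapRecursion

open Classical Finset

variable (K V : Type*) [Field K] [AddCommGroup V] [Module K V] [Fintype V]

/-- The number of caps of `n` vectors. -/
noncomputable def vecCapCard (n : ℕ) : ℤ :=
  (univ.filter fun v : Fin n → V => IsVecCap K v).card

/-- The number of caps of `n + 4` vectors the first four of which are dependent. -/
noncomputable def depCapCard (n : ℕ) : ℤ :=
  (univ.filter fun v : Fin (n + 4) → V => IsDepCap K V v).card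

/-- The number of caps of five vectors in a common three-dimensional subspace. -/
noncomputable def planarCapCard : ℤ :=
  (univ.filter fun v : Fin 5 → V => IsDepCap K V (n := 1) v ∧
    v (Fin.last 4) ∈ Submodule.span K (Set.range (Fin.init v : Fin 4 → V))).card

/-- The number of pairs of a cap of six vectors and a vector on the secants `01`, `23`, `45`. -/
noncomputable def concurrentCapCard : ℤ :=
  ∑ v ∈ univ.filter (fun v : Fin 6 → V => IsVecCap K v),
    ((univ.filter fun w : V => OnSecant K (v 0) (v 1) w ∧ OnSecant K (v 2) (v 3) w ∧
      OnSecant K (v 4) (v 5) w).card : ℤ)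

theorem isEmpty_embedding {m n : ℕ} (h : n < m) : IsEmpty (Fin m ↪ Fin n) := by
  rw [← Fintype.card_eq_zero_iff, Fintype.card_embedding_eq, Fintype.card_fin, Fintype.card_fin]
  exact Nat.descFactorial_eq_zero_iff_lt.2 h

variable {K V}

theorem sum_card_dependent (n : ℕ) :
    ∑ v ∈ univ.filter (fun v : Fin (n + 4) → V => IsVecCap K v),
      ((univ.filter fun t : Fin 4 ↪ Fin (n + 4) => ¬ LinearIndependent K (v ∘ t)).card : ℤ) =
    (n + 4).descFactorial 4 * depCapCard K V n := by
  have h := sum_isVecCap_embedding (K := K) (V := V) (n := n + 4) (k := 4)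
    (fun u => if LinearIndependent K u then 0 else 1) (Fin.castLEEmb (by omega))
  have e : ∀ v : Fin (n + 4) → V,
      ((univ.filter fun t : Fin 4 ↪ Fin (n + 4) => ¬ LinearIndependent K (v ∘ t)).card : ℤ) =
      ∑ t : Fin 4 ↪ Fin (n + 4), if LinearIndependent K (v ∘ t) then 0 else 1 := by
    intro v
    rw [card_filter, Nat.cast_sum]
    exact sum_congr rfl fun t _ => by split_ifs <;> simp
  rw [sum_congr rfl fun v _ => e v, h]
  congr 1
  have hf : (univ.filter fun v : Fin (n + 4) → V => IsDepCap K V v) =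
      (univ.filter fun v : Fin (n + 4) → V => IsVecCap K v).filter fun v =>
        ¬ LinearIndependent K (fun i : Fin 4 => v (Fin.castLE (by omega) i)) := by
    rw [filter_filter]
    exact filter_congr fun v _ => Iff.rfl
  rw [depCapCard, hf, card_filter, Nat.cast_sum]
  refine sum_congr rfl fun v _ => ?_
  change (if LinearIndependent K (fun i : Fin 4 => v (Fin.castLE (Nat.le_add_left 4 n) i)) then (0 : ℤ)
    else 1) = _
  split_ifs <;> simp

theorem sum_concurrent_six :
    ∑ v ∈ univ.filter (fun v : Fin 6 → V => IsVecCap K v), ∑ t : Fin 6 ↪ Fin 6,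
      ((univ.filter fun w : V => OnSecant K (v (t 0)) (v (t 1)) w ∧
        OnSecant K (v (t 2)) (v (t 3)) w ∧ OnSecant K (v (t 4)) (v (t 5)) w).card : ℤ) =
    720 * concurrentCapCard K V := by
  have h := sum_isVecCap_embedding (K := K) (V := V) (n := 6) (k := 6)
    (fun u => ((univ.filter fun w : V => OnSecant K (u 0) (u 1) w ∧
        OnSecant K (u 2) (u 3) w ∧ OnSecant K (u 4) (u 5) w).card : ℤ))
    (Function.Embedding.refl _)
  exact h

variable [Fintype K]

theorem vecCapCard_succ {n : ℕ} (hn : 3 ≤ n) (hn6 : n ≤ 6) :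
    48 * vecCapCard K V (n + 1) =
      (48 * (Fintype.card V - 1 - n * (Fintype.card K - 1)) -
        24 * (n * (n - 1) * (Fintype.card K - 1) ^ 2)) * vecCapCard K V n +
      6 * (Fintype.card K - 1) * ∑ v ∈ univ.filter (fun v : Fin n → V => IsVecCap K v),
        ((univ.filter fun t : Fin 4 ↪ Fin n => ¬ LinearIndependent K (v ∘ t)).card : ℤ) -
      ∑ v ∈ univ.filter (fun v : Fin n → V => IsVecCap K v), ∑ t : Fin 6 ↪ Fin n,
        ((univ.filter fun w : V => OnSecant K (v (t 0)) (v (t 1)) w ∧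
        OnSecant K (v (t 2)) (v (t 3)) w ∧ OnSecant K (v (t 4)) (v (t 5)) w).card : ℤ) := by
  unfold vecCapCard
  rw [card_fin_succ (fun v : Fin n → V => IsVecCap K v) (fun v w => ¬ IsCovered K v w)
      (isVecCap_succ_iff hn),
    Nat.cast_sum, mul_sum, mul_sum, mul_comm _ ((card _ : ℕ) : ℤ), ← nsmul_eq_mul, ← sum_const,
    ← sum_add_distrib, ← sum_sub_distrib]
  refine sum_congr rfl fun v hv => ?_
  have hv : IsVecCap K v := by simpa using hv
  rw [card_not_isCovered', mul_sub, hv.card_isCovered hn hn6]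
  ring

theorem vecCapCard_four :
    vecCapCard K V 4 = (Fintype.card V - 1 - 3 * (Fintype.card K - 1) -
      3 * (Fintype.card K - 1 : ℤ) ^ 2) * vecCapCard K V 3 := by
  have h := vecCapCard_succ (K := K) (V := V) (n := 3) le_rfl (by norm_num)
  have := isEmpty_embedding (show 3 < 4 by norm_num)
  have := isEmpty_embedding (show 3 < 6 by norm_num)
  simp only [univ_eq_empty, filter_empty, card_empty, sum_empty, Nat.cast_zero, sum_const_zero,
    Nat.cast_ofNat, Nat.reduceAdd] at h
  linarith

theorem vecCapCard_five :
    vecCapCard K V 5 = (Fintype.card V - 1 - 4 * (Fintype.card K - 1) -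
      6 * (Fintype.card K - 1 : ℤ) ^ 2) * vecCapCard K V 4 +
      3 * (Fintype.card K - 1) * depCapCard K V 0 := by
  have h := vecCapCard_succ (K := K) (V := V) (n := 4) (by norm_num) (by norm_num)
  have := isEmpty_embedding (show 4 < 6 by norm_num)
  have hd := sum_card_dependent (K := K) (V := V) 0
  simp only [Nat.zero_add, Nat.descFactorial] at hd
  rw [hd] at h
  simp only [univ_eq_empty, sum_empty, sum_const_zero] at h
  norm_num at h
  linarith

theorem vecCapCard_six :
    vecCapCard K V 6 = (Fintype.card V - 1 - 5 * (Fintype.card K - 1) -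
      10 * (Fintype.card K - 1 : ℤ) ^ 2) * vecCapCard K V 5 +
      15 * (Fintype.card K - 1) * depCapCard K V 1 := by
  have h := vecCapCard_succ (K := K) (V := V) (n := 5) (by norm_num) (by norm_num)
  have := isEmpty_embedding (show 5 < 6 by norm_num)
  have hd := sum_card_dependent (K := K) (V := V) 1
  simp only [Nat.reduceAdd, Nat.descFactorial] at hd
  rw [hd] at h
  simp only [univ_eq_empty, sum_empty, sum_const_zero] at h
  norm_num at h
  linarith

theorem vecCapCard_seven :
    vecCapCard K V 7 = (Fintype.card V - 1 - 6 * (Fintype.card K - 1) -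
      15 * (Fintype.card K - 1 : ℤ) ^ 2) * vecCapCard K V 6 +
      45 * (Fintype.card K - 1) * depCapCard K V 2 - 15 * concurrentCapCard K V := by
  have h := vecCapCard_succ (K := K) (V := V) (n := 6) (by norm_num) (by norm_num)
  have hd := sum_card_dependent (K := K) (V := V) 2
  simp only [Nat.reduceAdd, Nat.descFactorial] at hd
  rw [hd, sum_concurrent_six] at h
  norm_num at h
  linarith

theorem card_span_of_linearIndependent {n : ℕ} {v : Fin n → V} (h : LinearIndependent K v) :
    (Nat.card (Submodule.span K (Set.range v)) : ℤ) = (Fintype.card K : ℤ) ^ n := by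
  rw [Nat.card_eq_fintype_card, Module.card_eq_pow_finrank (K := K), finrank_span_eq_card h,
    Fintype.card_fin, Nat.cast_pow]

theorem depCapCard_zero :
    depCapCard K V 0 = (Fintype.card K - 1 : ℤ) ^ 3 * vecCapCard K V 3 := by
  unfold depCapCard vecCapCard
  rw [card_fin_succ (fun v : Fin 3 → V => IsVecCap K v) (fun v w =>
      w ∈ Submodule.span K (Set.range v) ∧ ¬ IsCovered K v w) isDepCap_zero_iff, Nat.cast_sum,
    mul_comm, ← nsmul_eq_mul, ← sum_const]
  refine sum_congr rfl fun v hv => ?_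
  have hv : IsVecCap K v := by simpa using hv
  rw [card_not_isCovered v (Submodule.span K (Set.range v))
      (fun i => Submodule.subset_span (Set.mem_range_self i)),
    card_span_of_linearIndependent (isVecCap_fin_three.1 hv)]
  have h := hv.card_isCovered (K := K) le_rfl (by norm_num)
  have := isEmpty_embedding (show 3 < 4 by norm_num)
  have := isEmpty_embedding (show 3 < 6 by norm_num)
  simp only [univ_eq_empty, filter_empty, card_empty, sum_empty, Nat.cast_zero,
    Nat.cast_ofNat] at h
  linarith

theorem IsDepCap.card_isCovered_four {v : Fin 4 → V} (h : IsDepCap K V (n := 0) v) :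
    ((univ.filter fun w : V => IsCovered K v w).card : ℤ) =
      1 + (Fintype.card K - 1) + 6 * (Fintype.card K - 1) ^ 2 := by
  have h1 := h.1.card_isCovered (K := K) (by norm_num) (by norm_num)
  have := isEmpty_embedding (show 4 < 6 by norm_num)
  have hall : (univ.filter fun t : Fin 4 ↪ Fin (0 + 4) => ¬ LinearIndependent K (v ∘ t)) = univ :=
    filter_true_of_mem fun t _ => h.not_linearIndependent_comp t
  rw [hall, card_univ, Fintype.card_embedding_eq, Fintype.card_fin] at h1
  simp only [univ_eq_empty, sum_empty, Nat.descFactorial] at h1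
  norm_num at h1
  linarith

theorem depCapCard_one :
    depCapCard K V 1 = (Fintype.card V - 1 - (Fintype.card K - 1) -
      6 * (Fintype.card K - 1 : ℤ) ^ 2) * depCapCard K V 0 := by
  unfold depCapCard
  rw [card_fin_succ (fun v : Fin 4 → V => IsDepCap K V (n := 0) v) (fun v w =>
      ¬ IsCovered K v w) (isDepCap_succ_iff (n := 0)), Nat.cast_sum, mul_comm, ← nsmul_eq_mul, ← sum_const]
  refine sum_congr rfl fun v hv => ?_
  have hv : IsDepCap K V (n := 0) v := by simpa using hv
  rw [card_not_isCovered', hv.card_isCovered_four]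
  ring

theorem planarCapCard_eq :
    planarCapCard K V = (Fintype.card K - 1) * (Fintype.card K - 2 : ℤ) * (Fintype.card K - 3) *
      depCapCard K V 0 := by
  unfold planarCapCard depCapCard
  have e : ∀ u : Fin 5 → V, (IsDepCap K V (n := 1) u ∧
      u (Fin.last 4) ∈ Submodule.span K (Set.range (Fin.init u : Fin 4 → V))) ↔
      IsDepCap K V (n := 0) (Fin.init u) ∧
      (u (Fin.last 4) ∈ Submodule.span K (Set.range (Fin.init u : Fin 4 → V)) ∧
      ¬ IsCovered K (Fin.init u : Fin 4 → V) (u (Fin.last 4))) := by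
    intro u
    rw [isDepCap_succ_iff (n := 0) u]
    tauto
  rw [card_fin_succ (fun v : Fin 4 → V => IsDepCap K V (n := 0) v) (fun v w =>
      w ∈ Submodule.span K (Set.range v) ∧ ¬ IsCovered K v w) e, Nat.cast_sum, mul_comm,
    ← nsmul_eq_mul, ← sum_const]
  refine sum_congr rfl fun v hv => ?_
  have hv : IsDepCap K V (n := 0) v := by simpa using hv
  rw [card_not_isCovered v (Submodule.span K (Set.range v))
      (fun i => Submodule.subset_span (Set.mem_range_self i)), hv.card_isCovered_four,
    hv.span_eq, card_span_of_linearIndependent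
      (isVecCap_fin_three.1 ((isDepCap_zero_iff v).1 hv).1)]
  ring

theorem depCapCard_two :
    depCapCard K V 2 = (Fintype.card V - 1 - 2 * (Fintype.card K - 1) -
      10 * (Fintype.card K - 1 : ℤ) ^ 2) * depCapCard K V 1 +
      12 * (Fintype.card K - 1) * planarCapCard K V := by
  unfold depCapCard planarCapCard
  rw [card_fin_succ (fun v : Fin 5 → V => IsDepCap K V (n := 1) v) (fun v w =>
      ¬ IsCovered K v w) (isDepCap_succ_iff (n := 1)), Nat.cast_sum, ← filter_filter, card_filter _
      (univ.filter fun v : Fin (1 + 4) → V => IsDepCap K V v), mul_comm _ ((card _ : ℕ) : ℤ),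
    ← nsmul_eq_mul, ← sum_const, Nat.cast_sum, mul_sum, ← sum_add_distrib]
  refine sum_congr rfl fun v hv => ?_
  have hv : IsDepCap K V (n := 1) v := by simpa using hv
  have h1 := hv.1.card_isCovered (K := K) (n := 5) (by norm_num) (by norm_num)
  have := isEmpty_embedding (show 5 < 6 by norm_num)
  have h2 := hv.card_dependent
  rw [h2] at h1
  simp only [univ_eq_empty, sum_empty] at h1
  rw [card_not_isCovered']
  split_ifs at h1 ⊢ <;> norm_num at h1 ⊢ <;> linarith

end CapRecursion

section FieldCount

open Classical Finset

variable (K : Type*) [Field K] [Fintype K]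

/-- The indicator of characteristic two. -/
noncomputable def charTwoIndicator : ℤ := if (2 : K) = 0 then 1 else 0

variable {K}

theorem card_filter_ne_zero_ne_one :
    ((univ.filter fun x : K => x ≠ 0 ∧ x ≠ 1).card : ℤ) = Fintype.card K - 2 := by
  have : (univ.filter fun x : K => x ≠ 0 ∧ x ≠ 1) = univ \ {0, 1} := by
    ext x; simp
  rw [this, card_sdiff_of_subset (subset_univ _), card_pair zero_ne_one, card_univ, Nat.cast_sub]
  · rfl
  · exact Fintype.one_lt_card

theorem card_filter_ne_neg_one :
    ((univ.filter fun x : K => (x ≠ 0 ∧ x ≠ 1) ∧ x ≠ -1).card : ℤ) =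
      Fintype.card K - 3 + charTwoIndicator K := by
  have h1 := card_filter_ne_zero_ne_one (K := K)
  rw [← filter_filter, filter_ne']
  unfold charTwoIndicator
  split_ifs with h2
  · rw [erase_eq_of_notMem]
    · linarith
    · have : (-1 : K) = 1 := by linear_combination -h2
      simp [this]
  · have hm : (-1 : K) ∈ univ.filter fun x : K => x ≠ 0 ∧ x ≠ 1 := by
      simp only [mem_filter, mem_univ, true_and]
      exact ⟨by simp, fun h => h2 (by linear_combination -h)⟩
    rw [card_erase_of_mem hm, Nat.cast_sub (card_pos.2 ⟨_, hm⟩)]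
    push_cast
    linarith

theorem card_pairs_sum_ne :
    ((univ.filter fun p : K × K => (p.1 ≠ 0 ∧ p.1 ≠ 1) ∧ (p.2 ≠ 0 ∧ p.2 ≠ 1) ∧
      p.1 + p.2 ≠ 0 ∧ p.1 + p.2 ≠ 1).card : ℤ) =
      (Fintype.card K - 3) ^ 2 - charTwoIndicator K := by
  set S := univ.filter fun x : K => x ≠ 0 ∧ x ≠ 1 with hS
  have hSm : ∀ {x : K}, x ∈ S ↔ x ≠ 0 ∧ x ≠ 1 := by simp [hS]
  have key : (univ.filter fun p : K × K => (p.1 ≠ 0 ∧ p.1 ≠ 1) ∧ (p.2 ≠ 0 ∧ p.2 ≠ 1) ∧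
      p.1 + p.2 ≠ 0 ∧ p.1 + p.2 ≠ 1).card =
      (S.sigma fun b => (S.erase (1 - b)).erase (-b)).card := by
    refine Finset.card_bij (fun p _ => ⟨p.1, p.2⟩) ?_ ?_ ?_
    · rintro ⟨b, c⟩ h
      simp only [mem_filter, mem_univ, true_and] at h
      simp only [mem_sigma, mem_erase, hSm]
      refine ⟨h.1, ?_, ?_, h.2.1⟩
      · rintro rfl; exact h.2.2.1 (by ring)
      · rintro rfl; exact h.2.2.2 (by ring)
    · rintro ⟨b, c⟩ _ ⟨b', c'⟩ _ h
      simpa using h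
    · rintro ⟨b, c⟩ h
      simp only [mem_sigma, mem_erase, hSm] at h
      refine ⟨(b, c), ?_, rfl⟩
      simp only [mem_filter, mem_univ, true_and]
      refine ⟨h.1, h.2.2.2, fun e => h.2.1 ?_, fun e => h.2.2.1 ?_⟩
      · linear_combination e
      · linear_combination e
  have hc : ∀ b ∈ S, (((S.erase (1 - b)).erase (-b)).card : ℤ) =
      S.card - 1 - if b ≠ -1 then 1 else 0 := by
    intro b hb
    rw [hSm] at hb
    have h1 : 1 - b ∈ S := by
      rw [hSm]
      exact ⟨fun e => hb.2 (by linear_combination -e), fun e => hb.1 (by linear_combination -e)⟩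
    have h2 : ((S.erase (1 - b)).card : ℤ) = S.card - 1 := by
      rw [card_erase_of_mem h1, Nat.cast_sub (card_pos.2 ⟨_, h1⟩), Nat.cast_one]
    split_ifs with hb1
    · have h3 : -b ∈ S.erase (1 - b) := by
        rw [mem_erase, hSm]
        refine ⟨fun e => one_ne_zero (α := K) (by linear_combination -e), neg_ne_zero.2 hb.1,
          fun e => hb1 (by linear_combination -e)⟩
      rw [card_erase_of_mem h3, Nat.cast_sub (card_pos.2 ⟨_, h3⟩), h2, Nat.cast_one]
    · have h3 : -b ∉ S.erase (1 - b) := by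
        rw [mem_erase, hSm]
        rw [ne_eq, not_not] at hb1
        rintro ⟨-, -, h⟩
        exact h (by rw [hb1, neg_neg])
      rw [erase_eq_of_notMem h3, h2, sub_zero]
  have h4 := card_filter_ne_neg_one (K := K)
  rw [← filter_filter, ← hS, card_filter, Nat.cast_sum] at h4
  have h5 := card_filter_ne_zero_ne_one (K := K)
  rw [← hS] at h5
  rw [key, card_sigma, Nat.cast_sum, sum_congr rfl hc, sum_sub_distrib, sum_const, nsmul_eq_mul]
  push_cast at h4
  rw [h4, h5]
  ring

theorem card_triples_ne :
    ((univ.filter fun p : K × K × K => (p.1 ≠ 0 ∧ p.1 ≠ 1) ∧ (p.2.1 ≠ 0 ∧ p.2.1 ≠ 1) ∧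
      (p.2.2 ≠ 0 ∧ p.2.2 ≠ 1) ∧ p.2.1 ≠ p.1 ∧ p.2.2 ≠ p.1).card : ℤ) =
      (Fintype.card K - 2) * (Fintype.card K - 3) ^ 2 := by
  set S := univ.filter fun x : K => x ≠ 0 ∧ x ≠ 1 with hS
  have hSm : ∀ {x : K}, x ∈ S ↔ x ≠ 0 ∧ x ≠ 1 := by simp [hS]
  have key : (univ.filter fun p : K × K × K => (p.1 ≠ 0 ∧ p.1 ≠ 1) ∧ (p.2.1 ≠ 0 ∧ p.2.1 ≠ 1) ∧
      (p.2.2 ≠ 0 ∧ p.2.2 ≠ 1) ∧ p.2.1 ≠ p.1 ∧ p.2.2 ≠ p.1).card =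
      (S.sigma fun a => (S.erase a) ×ˢ (S.erase a)).card := by
    refine Finset.card_bij (fun p _ => ⟨p.1, p.2⟩) ?_ ?_ ?_
    · rintro ⟨a, b, c⟩ h
      simp only [mem_filter, mem_univ, true_and] at h
      simp only [mem_sigma, mem_product, mem_erase, hSm]
      tauto
    · rintro ⟨a, b, c⟩ _ ⟨a', b', c'⟩ _ h
      simpa using h
    · rintro ⟨a, b, c⟩ h
      simp only [mem_sigma, mem_product, mem_erase, hSm] at h
      refine ⟨(a, b, c), ?_, rfl⟩
      simp only [mem_filter, mem_univ, true_and]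
      tauto
  have h5 := card_filter_ne_zero_ne_one (K := K)
  rw [← hS] at h5
  have hc : ∀ a ∈ S, (((S.erase a) ×ˢ (S.erase a)).card : ℤ) = (Fintype.card K - 3) ^ 2 := by
    intro a ha
    rw [card_product, Nat.cast_mul, card_erase_of_mem ha, Nat.cast_sub (card_pos.2 ⟨_, ha⟩), h5]
    push_cast
    ring
  rw [key, card_sigma, Nat.cast_sum, sum_congr rfl hc, sum_const, nsmul_eq_mul, h5]

/-- The coordinates of a fifth point completing a quadrangle to a hexagon with concurrent
diagonals. -/
def IsHexagonCoord (a : Fin 3 → K) : Prop :=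
  a 1 ≠ 0 ∧ a 2 ≠ 0 ∧ (a 0 ≠ 0 ∧ a 0 ≠ 1) ∧ (a 0 + a 1 ≠ 0 ∧ a 0 + a 1 ≠ 1) ∧
    (a 0 + a 2 ≠ 0 ∧ a 0 + a 2 ≠ 1) ∧ (a 0 + a 1 + a 2 ≠ 0 ∧ a 0 + a 1 + a 2 ≠ 1)

theorem card_isHexagonCoord :
    ((univ.filter fun a : Fin 3 → K => IsHexagonCoord a).card : ℤ) =
      (Fintype.card K - 3) ^ 2 * (Fintype.card K - 4) + 2 * charTwoIndicator K := by
  set T := univ.filter fun p : K × K × K => (p.1 ≠ 0 ∧ p.1 ≠ 1) ∧ (p.2.1 ≠ 0 ∧ p.2.1 ≠ 1) ∧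
      (p.2.2 ≠ 0 ∧ p.2.2 ≠ 1) ∧ p.2.1 ≠ p.1 ∧ p.2.2 ≠ p.1 with hT
  have hTm : ∀ {a b c : K}, (a, b, c) ∈ T ↔ (a ≠ 0 ∧ a ≠ 1) ∧ (b ≠ 0 ∧ b ≠ 1) ∧
      (c ≠ 0 ∧ c ≠ 1) ∧ b ≠ a ∧ c ≠ a := by simp [hT]
  have key : (univ.filter fun a : Fin 3 → K => IsHexagonCoord a).card =
      ((T.filter fun p => ¬ p.2.1 + p.2.2 = p.1).filter fun p => ¬ p.2.1 + p.2.2 = p.1 + 1).card := by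
    refine Finset.card_bij (fun a _ => (a 0, a 0 + a 1, a 0 + a 2)) ?_ ?_ ?_
    · intro a ha
      obtain ⟨h1, h2, h3, h4, h5, h6, h7⟩ : IsHexagonCoord a := by simpa using ha
      rw [mem_filter, mem_filter, hTm]
      refine ⟨⟨⟨h3, h4, h5, by simpa using h1, by simpa using h2⟩, fun e => h6 ?_⟩, fun e => h7 ?_⟩
      · linear_combination e
      · linear_combination e
    · intro a _ b _ h
      simp only [Prod.mk.injEq] at h
      obtain ⟨h0, h1, h2⟩ := h
      rw [h0] at h1 h2
      funext i
      fin_cases i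
      · exact h0
      · exact add_left_cancel h1
      · exact add_left_cancel h2
    · rintro ⟨a, b, c⟩ h
      rw [mem_filter, mem_filter, hTm] at h
      obtain ⟨⟨⟨h1, h2, h3, h4, h5⟩, h6⟩, h7⟩ := h
      refine ⟨![a, b - a, c - a], ?_, by simp⟩
      refine mem_filter.2 ⟨mem_univ _, ?_⟩
      simp only [IsHexagonCoord, Matrix.cons_val]
      refine ⟨sub_ne_zero.2 h4, sub_ne_zero.2 h5, h1, by simpa using h2, by simpa using h3,
        fun e => h6 ?_, fun e => h7 ?_⟩
      · linear_combination e
      · linear_combination e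
  have h0 : ((T.filter fun p => p.2.1 + p.2.2 = p.1).card : ℤ) =
      (Fintype.card K - 3) ^ 2 - charTwoIndicator K := by
    rw [← card_pairs_sum_ne]
    congr 1
    refine Finset.card_bij (fun p _ => p.2) ?_ ?_ ?_
    · rintro ⟨a, b, c⟩ h
      rw [mem_filter, hTm] at h
      obtain ⟨h, h'⟩ := h
      dsimp only at h'
      subst h'
      simp only [mem_filter, mem_univ, true_and]
      tauto
    · rintro ⟨a, b, c⟩ h ⟨a', b', c'⟩ h' e
      rw [mem_filter] at h h'
      have h := h.2
      have h' := h'.2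
      simp only at e h h'
      rw [Prod.mk.injEq] at e
      rw [← h, ← h', e.1, e.2]
    · rintro ⟨b, c⟩ h
      simp only [mem_filter, mem_univ, true_and] at h
      refine ⟨(b + c, b, c), ?_, rfl⟩
      rw [mem_filter, hTm]
      refine ⟨⟨h.2.2, h.1, h.2.1, ?_, ?_⟩, rfl⟩
      · simpa [eq_comm] using h.2.1.1
      · simpa [eq_comm] using h.1.1
  have h1 : ((T.filter fun p => ¬ p.2.1 + p.2.2 = p.1).filter
      fun p => p.2.1 + p.2.2 = p.1 + 1).card = (T.filter fun p => p.2.1 + p.2.2 = p.1).card := by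
    refine Finset.card_bij (fun p _ => (1 - p.1, 1 - p.2.1, 1 - p.2.2)) ?_ ?_ ?_
    · rintro ⟨a, b, c⟩ h
      rw [mem_filter, mem_filter, hTm] at h
      obtain ⟨⟨⟨h1, h2, h3, h4, h5⟩, h6⟩, h7⟩ := h
      rw [mem_filter, hTm]
      dsimp only at h7 ⊢
      refine ⟨?_, by linear_combination -h7⟩
      simp only [ne_eq, sub_eq_zero, sub_eq_self, sub_right_inj]
      tauto
    · rintro ⟨a, b, c⟩ _ ⟨a', b', c'⟩ _ h
      simpa using h
    · rintro ⟨a, b, c⟩ h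
      rw [mem_filter, hTm] at h
      obtain ⟨⟨h1, h2, h3, h4, h5⟩, h6⟩ := h
      dsimp only at h6
      refine ⟨(1 - a, 1 - b, 1 - c), ?_, by simp⟩
      rw [mem_filter, mem_filter, hTm]
      dsimp only
      refine ⟨⟨?_, fun e => one_ne_zero (α := K) (by linear_combination e + h6)⟩,
        by linear_combination -h6⟩
      simp only [ne_eq, sub_eq_zero, sub_eq_self, sub_right_inj]
      tauto
  have h2 := card_filter_add_card_filter_not (s := T) (fun p => p.2.1 + p.2.2 = p.1)
  have h3 := card_filter_add_card_filter_not (s := T.filter fun p => ¬ p.2.1 + p.2.2 = p.1)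
    (fun p => p.2.1 + p.2.2 = p.1 + 1)
  have h4 := card_triples_ne (K := K)
  rw [← hT] at h4
  rw [key]
  zify at h1 h2 h3
  linear_combination h3 + h2 + h4 - h1 - 2 * h0

end FieldCount

section ConcurrentCaps

open Classical Finset

variable {K V : Type*} [Field K] [AddCommGroup V] [Module K V]

/-- Being a cap can be tested on the coordinates with respect to linearly independent vectors. -/
theorem isVecCap_linearCombination {ι : Type*} {m : ℕ} {e : Fin m → V}
    (he : LinearIndependent K e) (B : ι → Fin m → K) :
    IsVecCap K (fun i => ∑ j, B i j • e j) ↔ IsVecCap K B := by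
  have hinj : Function.Injective (Fintype.linearCombination K e) :=
    linearIndependent_iff_injective_fintypeLinearCombination.1 he
  unfold IsVecCap
  refine forall_congr' fun i => forall_congr' fun j => forall_congr' fun k => ?_
  have : ![∑ a, B i a • e a, ∑ a, B j a • e a, ∑ a, B k a • e a] =
      Fintype.linearCombination K e ∘ ![B i, B j, B k] := by
    funext a
    fin_cases a <;> simp [Fintype.linearCombination_apply]
  rw [this, LinearMap.linearIndependent_iff _ (LinearMap.ker_eq_bot.2 hinj)]

theorem isVecCap_iff_of_lt {n : ℕ} {v : Fin n → V} :
    IsVecCap K v ↔ ∀ i j k, i < j → j < k → LinearIndependent K ![v i, v j, v k] := by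
  constructor
  · intro h i j k hij hjk
    exact h i j k hij.ne (hij.trans hjk).ne hjk.ne
  · intro h
    have h' : ∀ i j k, i < j → j < k → ∀ x y z : K, x • v i + y • v j + z • v k = 0 →
        x = 0 ∧ y = 0 ∧ z = 0 := fun i j k hij hjk =>
      linearIndependent_triple_iff.1 (h i j k hij hjk)
    intro i j k hij hik hjk
    rw [linearIndependent_triple_iff]
    intro x y z he
    rcases lt_or_gt_of_ne hij with h1 | h1 <;> rcases lt_or_gt_of_ne hik with h2 | h2 <;>
      rcases lt_or_gt_of_ne hjk with h3 | h3
    · exact h' i j k h1 h3 x y z he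
    · have := h' i k j h2 h3 x z y (by rw [← he]; abel)
      tauto
    · exact absurd (h1.trans h3) (not_lt.2 h2.le)
    · have := h' k i j h2 h1 z x y (by rw [← he]; abel)
      tauto
    · have := h' j i k h1 h2 y x z (by rw [← he]; abel)
      tauto
    · exact absurd (h3.trans h1) (not_lt.2 h2.le)
    · have := h' j k i h3 h2 y z x (by rw [← he]; abel)
      tauto
    · have := h' k j i h3 h1 z y x (by rw [← he]; abel)
      tauto

theorem forall_lt_fin_six {P : Fin 6 → Fin 6 → Fin 6 → Prop} :
    (∀ i j k, i < j → j < k → P i j k) ↔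
      P 0 1 2 ∧ P 0 1 3 ∧ P 0 1 4 ∧ P 0 1 5 ∧ P 0 2 3 ∧ P 0 2 4 ∧ P 0 2 5 ∧ P 0 3 4 ∧ P 0 3 5 ∧
      P 0 4 5 ∧ P 1 2 3 ∧ P 1 2 4 ∧ P 1 2 5 ∧ P 1 3 4 ∧ P 1 3 5 ∧ P 1 4 5 ∧ P 2 3 4 ∧ P 2 3 5 ∧
      P 2 4 5 ∧ P 3 4 5 := by
  constructor
  · intro h
    refine ⟨?_, ?_, ?_, ?_, ?_, ?_, ?_, ?_, ?_, ?_, ?_, ?_, ?_, ?_, ?_, ?_, ?_, ?_, ?_, ?_⟩ <;>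
      exact h _ _ _ (by decide) (by decide)
  · rintro ⟨h1, h2, h3, h4, h5, h6, h7, h8, h9, h10, h11, h12, h13, h14, h15, h16, h17, h18, h19,
      h20⟩ i j k hij hjk
    fin_cases i <;> fin_cases j <;> first
      | exact absurd hij (by decide)
      | (fin_cases k <;> first | exact absurd hjk (by decide) | assumption)

theorem linearIndependent_rows_three {a b c : Fin 3 → K} :
    LinearIndependent K ![a, b, c] ↔
      a 0 * b 1 * c 2 - a 0 * b 2 * c 1 - a 1 * b 0 * c 2 + a 1 * b 2 * c 0 + a 2 * b 0 * c 1 -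
        a 2 * b 1 * c 0 ≠ 0 := by
  have := Matrix.linearIndependent_rows_iff_isUnit (A := (Matrix.of ![a, b, c]))
  rw [Matrix.isUnit_iff_isUnit_det, Matrix.det_fin_three, isUnit_iff_ne_zero] at this
  exact this

/-- The coordinates of a hexagon with concurrent diagonals in a plane. -/
def hexagonRows (a : Fin 3 → K) : Fin 6 → Fin 3 → K :=
  ![![0, 1, 0], ![1, -1, 0], ![0, 0, 1], ![1, 0, -1], ![a 0, a 1, a 2], ![1 - a 0, -a 1, -a 2]]

theorem isVecCap_hexagonRows [Fintype K] (a : Fin 3 → K) :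
    IsVecCap K (hexagonRows a) ↔ IsHexagonCoord a := by
  rw [isVecCap_iff_of_lt, forall_lt_fin_six]
  simp only [linearIndependent_rows_three, hexagonRows, Matrix.cons_val, IsHexagonCoord]
  constructor
  · rintro ⟨h1, h2, h3, h4, h5, h6, h7, h8, h9, h10, h11, h12, h13, h14, h15, h16, h17, h18, h19,
      h20⟩
    refine ⟨?_, ?_, ⟨?_, ?_⟩, ⟨?_, ?_⟩, ⟨?_, ?_⟩, ?_, ?_⟩ <;> grind
  · rintro ⟨h1, h2, ⟨h3, h4⟩, ⟨h5, h6⟩, ⟨h7, h8⟩, h9, h10⟩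
    refine ⟨?_, ?_, ?_, ?_, ?_, ?_, ?_, ?_, ?_, ?_, ?_, ?_, ?_, ?_, ?_, ?_, ?_, ?_, ?_, ?_⟩ <;> grind

variable (K) in
/-- The coordinates of six points on three concurrent lines that are not coplanar. -/
def tripodRows : Fin 6 → Fin 4 → K :=
  ![![0, 1, 0, 0], ![1, -1, 0, 0], ![0, 0, 1, 0], ![1, 0, -1, 0], ![0, 0, 0, 1], ![1, 0, 0, -1]]

theorem isVecCap_tripodRows : IsVecCap K (tripodRows K) := by
  rw [isVecCap_iff_of_lt, forall_lt_fin_six]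
  simp only [linearIndependent_triple_iff, tripodRows, Matrix.cons_val]
  refine ⟨?_, ?_, ?_, ?_, ?_, ?_, ?_, ?_, ?_, ?_, ?_, ?_, ?_, ?_, ?_, ?_, ?_, ?_, ?_, ?_⟩ <;>
    (intro x y z h
     have h0 := congr_fun h 0
     have h1 := congr_fun h 1
     have h2 := congr_fun h 2
     have h3 := congr_fun h 3
     simp at h0 h1 h2 h3
     grind)

/-- The six points on three lines through the point `p 0`. -/
def sixOnLines (p : Fin 4 → V) : Fin 6 → V :=
  ![p 1, p 0 - p 1, p 2, p 0 - p 2, p 3, p 0 - p 3]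

theorem isVecCap_sixOnLines_of_linearIndependent {p : Fin 4 → V} (hp : LinearIndependent K p) :
    IsVecCap K (sixOnLines p) := by
  have h := (isVecCap_linearCombination hp (tripodRows K)).2 isVecCap_tripodRows
  convert h using 1
  funext i
  fin_cases i <;> simp [sixOnLines, tripodRows, Fin.sum_univ_four] <;> module

theorem isVecCap_sixOnLines_of_coord [Fintype K] {p : Fin 4 → V}
    (hp : LinearIndependent K (Fin.init p : Fin 3 → V)) {a : Fin 3 → K}
    (ha : p (Fin.last 3) = ∑ i, a i • (Fin.init p : Fin 3 → V) i) :
    IsVecCap K (sixOnLines p) ↔ IsHexagonCoord a := by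
  rw [← isVecCap_hexagonRows, ← isVecCap_linearCombination hp]
  have ha : p 3 = a 0 • p 0 + a 1 • p 1 + a 2 • p 2 := by
    rw [Fin.sum_univ_three] at ha
    exact ha
  have : sixOnLines p = fun i => ∑ j, hexagonRows a i j • (Fin.init p : Fin 3 → V) j := by
    funext i
    have e0 : (Fin.init p : Fin 3 → V) 0 = p 0 := rfl
    have e1 : (Fin.init p : Fin 3 → V) 1 = p 1 := rfl
    have e2 : (Fin.init p : Fin 3 → V) 2 = p 2 := rfl
    rw [Fin.sum_univ_three, e0, e1, e2]
    fin_cases i <;> simp [sixOnLines, hexagonRows, ha] <;> module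
  rw [this]

theorem linearIndependent_init_of_isVecCap_sixOnLines {p : Fin 4 → V}
    (h : IsVecCap K (sixOnLines p)) : LinearIndependent K (Fin.init p : Fin 3 → V) := by
  have h3 := linearIndependent_triple_iff.1 (h 0 1 2 (by decide) (by decide) (by decide))
  have : (Fin.init p : Fin 3 → V) = ![p 0, p 1, p 2] := by
    funext i; fin_cases i <;> rfl
  rw [this, linearIndependent_triple_iff]
  intro x y z he
  have := h3 (x + y) x z (by
    simp only [sixOnLines, Matrix.cons_val]
    linear_combination (norm := module) he)
  obtain ⟨h1, h2, h3⟩ := this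
  subst h2
  exact ⟨rfl, by simpa using h1, h3⟩

theorem IsVecCap.smul {ι : Type*} {v : ι → V} (h : IsVecCap K v) {c : ι → K} (hc : ∀ i, c i ≠ 0) :
    IsVecCap K (fun i => c i • v i) := by
  intro i j k hij hik hjk
  rw [linearIndependent_triple_iff]
  intro x y z he
  have := h.triple hij hik hjk (x * c i) (y * c j) (z * c k) (by
    linear_combination (norm := module) he)
  simpa [hc] using this

theorem smul_eq_of_add_eq {a b a' b' : V} (hab : ∀ x y : K, x • a + y • b = 0 → x = 0 ∧ y = 0)
    {c d c' d' : K} (hc : c' ≠ 0) (hd : d' ≠ 0) (ha : c • a = c' • a') (hb : d • b = d' • b')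
    (h : a + b = a' + b') : c = c' ∧ d = d' := by
  have := hab (c' * d' - d' * c) (c' * d' - c' * d) (by
    linear_combination (norm := module) (c' * d') • h - d' • ha - c' • hb)
  constructor
  · exact (mul_left_cancel₀ hd (by linear_combination this.1)).symm
  · exact (mul_left_cancel₀ hc (by linear_combination this.2)).symm

variable [Fintype V] [Fintype K]

variable (K V) in
/-- The number of linearly independent `n`-tuples. -/
noncomputable def linIndepCard (n : ℕ) : ℤ :=
  (univ.filter fun v : Fin n → V => LinearIndependent K v).card

theorem card_sixOnLines :
    ((univ.filter fun p : Fin 4 → V => IsVecCap K (sixOnLines p)).card : ℤ) =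
      linIndepCard K V 4 + linIndepCard K V 3 *
        ((Fintype.card K - 3) ^ 2 * (Fintype.card K - 4) + 2 * charTwoIndicator K) := by
  have h := card_filter_add_card_filter_not
    (s := univ.filter fun p : Fin 4 → V => IsVecCap K (sixOnLines p))
    (fun p => LinearIndependent K p)
  rw [filter_filter, filter_filter] at h
  have h1 : (univ.filter fun p : Fin 4 → V => IsVecCap K (sixOnLines p) ∧ LinearIndependent K p) =
      univ.filter fun p : Fin 4 → V => LinearIndependent K p :=
    filter_congr fun p _ => ⟨fun h => h.2,
      fun h => ⟨isVecCap_sixOnLines_of_linearIndependent h, h⟩⟩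
  have h2 : ∀ p : Fin 4 → V, (IsVecCap K (sixOnLines p) ∧ ¬ LinearIndependent K p) ↔
      LinearIndependent K (Fin.init p : Fin 3 → V) ∧ ∃ a : Fin 3 → K, IsHexagonCoord a ∧
        p (Fin.last 3) = ∑ i, a i • (Fin.init p : Fin 3 → V) i := by
    intro p
    constructor
    · rintro ⟨hc, hd⟩
      have hi := linearIndependent_init_of_isVecCap_sixOnLines hc
      rw [linearIndependent_succ_iff, not_and, not_not] at hd
      obtain ⟨a, ha⟩ := (Submodule.mem_span_range_iff_exists_fun K).1 (hd hi)
      exact ⟨hi, a, (isVecCap_sixOnLines_of_coord hi ha.symm).1 hc, ha.symm⟩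
    · rintro ⟨hi, a, hH, ha⟩
      refine ⟨(isVecCap_sixOnLines_of_coord hi ha).2 hH, ?_⟩
      rw [linearIndependent_succ_iff, not_and, not_not]
      intro _
      rw [ha]
      exact Submodule.sum_mem _ fun i _ => Submodule.smul_mem _ _ (Submodule.subset_span ⟨i, rfl⟩)
  rw [h1, card_fin_succ (fun v : Fin 3 → V => LinearIndependent K v)
    (fun v w => ∃ a : Fin 3 → K, IsHexagonCoord a ∧ w = ∑ i, a i • v i) h2] at h
  rw [← h, Nat.cast_add, linIndepCard, linIndepCard, Nat.cast_sum, ← nsmul_eq_mul, ← sum_const]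
  congr 1
  refine sum_congr rfl fun v hv => ?_
  have hv : LinearIndependent K v := by simpa using hv
  rw [← card_isHexagonCoord]
  congr 1
  symm
  refine Finset.card_bij (fun a _ => ∑ i, a i • v i) ?_ ?_ ?_
  · intro a ha
    simp only [mem_filter, mem_univ, true_and] at ha ⊢
    exact ⟨a, ha, rfl⟩
  · intro a _ b _ hab
    exact linearIndependent_iff_injective_fintypeLinearCombination.1 hv (by
      simpa [Fintype.linearCombination_apply] using hab)
  · intro w hw
    simp only [mem_filter, mem_univ, true_and] at hw
    obtain ⟨a, ha, rfl⟩ := hw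
    exact ⟨a, by simpa using ha, rfl⟩

theorem card_pi_ne_zero (n : ℕ) :
    ((univ.filter fun c : Fin n → K => ∀ i, c i ≠ 0).card : ℤ) = (Fintype.card K - 1) ^ n := by
  have : (univ.filter fun c : Fin n → K => ∀ i, c i ≠ 0) =
      Fintype.piFinset fun _ => univ.filter fun x : K => x ≠ 0 := by
    ext c; simp
  rw [this, Fintype.card_piFinset_const, Nat.cast_pow, card_filter_ne_zero]

theorem concurrentCapCard_eq :
    concurrentCapCard K V = (Fintype.card K - 1) ^ 6 *
      (univ.filter fun p : Fin 4 → V => IsVecCap K (sixOnLines p)).card := by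
  rw [concurrentCapCard, ← card_pi_ne_zero, ← Nat.cast_sum, ← card_sigma, ← Nat.cast_mul,
    ← card_product]
  congr 1
  symm
  refine Finset.card_bij (fun x _ => ⟨fun i => x.1 i • sixOnLines x.2 i, x.2 0⟩) ?_ ?_ ?_
  · rintro ⟨c, p⟩ h
    simp only [mem_product, mem_filter, mem_univ, true_and] at h
    simp only [mem_sigma, mem_filter, mem_univ, true_and]
    refine ⟨h.2.smul h.1, ?_, ?_, ?_⟩
    · refine ⟨(c 0)⁻¹, (c 1)⁻¹, inv_ne_zero (h.1 0), inv_ne_zero (h.1 1), ?_⟩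
      rw [smul_smul, smul_smul, inv_mul_cancel₀ (h.1 0), inv_mul_cancel₀ (h.1 1)]
      simp [sixOnLines]
    · refine ⟨(c 2)⁻¹, (c 3)⁻¹, inv_ne_zero (h.1 2), inv_ne_zero (h.1 3), ?_⟩
      rw [smul_smul, smul_smul, inv_mul_cancel₀ (h.1 2), inv_mul_cancel₀ (h.1 3)]
      simp [sixOnLines]
    · refine ⟨(c 4)⁻¹, (c 5)⁻¹, inv_ne_zero (h.1 4), inv_ne_zero (h.1 5), ?_⟩
      rw [smul_smul, smul_smul, inv_mul_cancel₀ (h.1 4), inv_mul_cancel₀ (h.1 5)]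
      simp [sixOnLines]
  · rintro ⟨c, p⟩ h ⟨c', p'⟩ h' e
    simp only [mem_product, mem_filter, mem_univ, true_and] at h h'
    simp only [Sigma.mk.injEq, heq_eq_eq] at e
    obtain ⟨e1, e2⟩ := e
    have hpair : ∀ i j, i ≠ j → sixOnLines p i + sixOnLines p j = sixOnLines p' i + sixOnLines p' j →
        c i = c' i ∧ c j = c' j := fun i j hij hs =>
      smul_eq_of_add_eq (h.2.pair (by norm_num) hij) (h'.1 i) (h'.1 j) (congr_fun e1 i)
        (congr_fun e1 j) hs
    have h01 := hpair 0 1 (by decide) (by simpa [sixOnLines] using e2)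
    have h23 := hpair 2 3 (by decide) (by simpa [sixOnLines] using e2)
    have h45 := hpair 4 5 (by decide) (by simpa [sixOnLines] using e2)
    have hc : c = c' := by
      funext i
      fin_cases i
      exacts [h01.1, h01.2, h23.1, h23.2, h45.1, h45.2]
    subst hc
    have hs : ∀ i, sixOnLines p i = sixOnLines p' i := fun i =>
      smul_right_injective V (h.1 i) (congr_fun e1 i)
    refine Prod.ext rfl ?_
    funext i
    fin_cases i
    exacts [e2, hs 0, hs 2, hs 4]
  · rintro ⟨v, w⟩ h
    simp only [mem_sigma, mem_filter, mem_univ, true_and] at h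
    obtain ⟨hv, ⟨x0, x1, hx0, hx1, h01⟩, ⟨x2, x3, hx2, hx3, h23⟩, x4, x5, hx4, hx5, h45⟩ := h
    have hU : sixOnLines ![w, x0 • v 0, x2 • v 2, x4 • v 4] =
        fun i => ![x0, x1, x2, x3, x4, x5] i • v i := by
      funext i
      fin_cases i
      · simp [sixOnLines]
      · simp [sixOnLines, h01]
      · simp [sixOnLines]
      · simp [sixOnLines, h23]
      · simp [sixOnLines]
      · simp [sixOnLines, h45]
    have hne : ∀ i, ![x0, x1, x2, x3, x4, x5] i ≠ 0 := by
      intro i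
      fin_cases i <;> assumption
    refine ⟨(fun i => (![x0, x1, x2, x3, x4, x5] i)⁻¹, ![w, x0 • v 0, x2 • v 2, x4 • v 4]), ?_, ?_⟩
    · simp only [mem_product, mem_filter, mem_univ, true_and]
      refine ⟨fun i => inv_ne_zero (hne i), ?_⟩
      rw [hU]
      exact hv.smul hne
    · simp only [Sigma.mk.injEq]
      refine ⟨?_, by simp⟩
      rw [hU]
      funext i
      rw [smul_smul, inv_mul_cancel₀ (hne i), one_smul]

end ConcurrentCaps

section ProjectiveCounts

open Classical Finset

variable {K V : Type*} [Field K] [AddCommGroup V] [Module K V]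

variable (K) in
/-- The family of points represented by the vectors `v i`. -/
def mkPoints {ι : Type*} (v : ι → V) (h : ∀ i, v i ≠ 0) : ι → Projectivization K V :=
  fun i => Projectivization.mk K (v i) (h i)

/-- Each point of the projective space has `|K| - 1` representatives. -/
theorem card_points_mul [Fintype K] [Fintype V] {n : ℕ}
    (P : (Fin n → Projectivization K V) → Prop) (Q : (Fin n → V) → Prop) [DecidablePred Q]
    (hQ : ∀ v, (∃ h : ∀ i, v i ≠ 0, P (mkPoints K v h)) ↔ Q v) :
    (Nat.card {σ : Fin n → Projectivization K V // P σ} : ℤ) * (Fintype.card K - 1) ^ n =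
      (univ.filter Q).card := by
  have hu : (Nat.card (Fin n → Kˣ) : ℤ) = (Fintype.card K - 1) ^ n := by
    rw [Nat.card_eq_fintype_card, Fintype.card_fun, Fintype.card_fin, Fintype.card_units,
      Nat.cast_pow, Nat.cast_sub Fintype.card_pos, Nat.cast_one]
  rw [← hu, ← Nat.cast_mul, ← Nat.card_prod, ← Fintype.card_subtype, ← Nat.card_eq_fintype_card]
  congr 1
  have hmk : ∀ (p : Projectivization K V) (c : Kˣ) (h : (c : K) • p.rep ≠ 0),
      Projectivization.mk K ((c : K) • p.rep) h = p := by
    intro p c h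
    conv_rhs => rw [← p.mk_rep]
    rw [Projectivization.mk_eq_mk_iff]
    exact ⟨c, rfl⟩
  have hne : ∀ (p : Projectivization K V) (c : Kˣ), (c : K) • p.rep ≠ 0 := fun p c =>
    smul_ne_zero c.ne_zero p.rep_nonzero
  refine Nat.card_congr (Equiv.ofBijective (fun x => ⟨fun i => (x.2 i : K) • (x.1.1 i).rep,
    (hQ _).1 ⟨fun i => hne _ _, ?_⟩⟩) ⟨?_, ?_⟩)
  · have : mkPoints K (fun i => (x.2 i : K) • (x.1.1 i).rep) (fun i => hne _ _) = x.1.1 :=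
      funext fun i => hmk _ _ _
    rw [this]
    exact x.1.2
  · rintro ⟨⟨σ, hσ⟩, c⟩ ⟨⟨τ, hτ⟩, d⟩ h
    simp only [Subtype.mk.injEq] at h
    have h' := fun i => congr_fun h i
    have e : σ = τ := by
      funext i
      rw [← hmk (σ i) (c i) (hne _ _), ← hmk (τ i) (d i) (hne _ _)]
      congr 1
      exact h' i
    subst e
    have : c = d := by
      funext i
      exact Units.ext (smul_left_injective K (σ i).rep_nonzero (h' i))
    rw [this]
  · rintro ⟨v, hv⟩
    obtain ⟨h, hv⟩ := (hQ v).2 hv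
    choose a ha using fun i => Projectivization.exists_smul_eq_mk_rep K (v i) (h i)
    refine ⟨(⟨mkPoints K v h, hv⟩, fun i => (a i)⁻¹), ?_⟩
    simp only [Subtype.mk.injEq]
    funext i
    change ((a i)⁻¹ : Kˣ) • (Projectivization.mk K (v i) (h i)).rep = v i
    rw [← ha i, inv_smul_smul]

variable (K) in
/-- The vectors `v i`, `i ∈ S`, lie in a common subspace of dimension `d + 1`. -/
def OnFlat {ι : Type*} (d : ℕ) (v : ι → V) (S : Set ι) : Prop :=
  ∃ W : Submodule K V, Module.finrank K W = d + 1 ∧ ∀ i ∈ S, v i ∈ W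

variable (K) in
/-- Any two of the vectors are linearly independent. -/
def PairwiseIndep {ι : Type*} (v : ι → V) : Prop :=
  ∀ i j, i ≠ j → ∀ x y : K, x • v i + y • v j = 0 → x = 0 ∧ y = 0

theorem lieOnFlat_mkPoints_iff {ι : Type*} {d : ℕ} {v : ι → V} {h : ∀ i, v i ≠ 0} {S : Set ι} :
    LieOnFlat d (mkPoints K v h '' S) ↔ OnFlat K d v S := by
  unfold LieOnFlat OnFlat
  simp [mkPoints, Projectivization.submodule_mk]

theorem PairwiseIndep.ne_zero {n : ℕ} (hn : 2 ≤ n) {v : Fin n → V} (h : PairwiseIndep K v)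
    (i : Fin n) : v i ≠ 0 := by
  intro h0
  have : Nontrivial (Fin n) := Fin.nontrivial_iff_two_le.2 hn
  obtain ⟨j, hj⟩ := exists_ne i
  exact one_ne_zero (h i j hj.symm 1 0 (by simp [h0])).1

theorem injective_mkPoints_iff {ι : Type*} {v : ι → V} {h : ∀ i, v i ≠ 0} :
    Function.Injective (mkPoints K v h) ↔ PairwiseIndep K v := by
  constructor
  · intro hi i j hij x y he
    by_contra hne
    have hy : y ≠ 0 := by
      rintro rfl
      rw [zero_smul, add_zero, smul_eq_zero] at he
      exact hne ⟨he.resolve_right (h i), rfl⟩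
    apply hij
    apply hi
    unfold mkPoints
    rw [Projectivization.mk_eq_mk_iff']
    have hx : x ≠ 0 := by
      rintro rfl
      rw [zero_smul, zero_add, smul_eq_zero] at he
      exact hy (he.resolve_right (h j))
    refine ⟨-(y / x), ?_⟩
    apply smul_right_injective V hx
    dsimp only
    rw [smul_smul, show x * -(y / x) = -y by field_simp]
    linear_combination (norm := module) -he
  · intro hp i j hij
    by_contra hne
    unfold mkPoints at hij
    rw [Projectivization.mk_eq_mk_iff'] at hij
    obtain ⟨a, ha⟩ := hij
    have := hp i j hne (-1) a (by rw [ha]; module)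
    exact one_ne_zero (neg_eq_zero.1 this.1)

theorem finrank_span_range_le {n : ℕ} (u : Fin n → V) :
    Module.finrank K (Submodule.span K (Set.range u)) ≤ n := by
  have := finrank_range_le_card (R := K) u
  rwa [Set.finrank, Fintype.card_fin] at this

variable [FiniteDimensional K V]

theorem exists_finrank_eq_of_le {k : ℕ} (hk : k ≤ Module.finrank K V) (U : Submodule K V)
    (hU : Module.finrank K U ≤ k) : ∃ W : Submodule K V, U ≤ W ∧ Module.finrank K W = k := by
  obtain ⟨m, hm⟩ := Nat.exists_eq_add_of_le hU
  induction m generalizing U with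
  | zero => exact ⟨U, le_rfl, hm.symm⟩
  | succ m ih =>
    have hne : U ≠ ⊤ := by
      rintro rfl
      rw [finrank_top] at hm
      omega
    obtain ⟨x, hx⟩ : ∃ x, x ∉ U := by
      by_contra hall
      push Not at hall
      exact hne (Submodule.eq_top_iff'.2 hall)
    have h1 := Submodule.finrank_sup_span_singleton hx
    obtain ⟨W, hW, hWk⟩ := ih (U ⊔ Submodule.span K {x}) (by omega) (by omega)
    exact ⟨W, le_sup_left.trans hW, hWk⟩

theorem onFlat_of_finrank_le {ι : Type*} {d : ℕ} (hd : d + 1 ≤ Module.finrank K V) {v : ι → V}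
    {S : Set ι} (W : Submodule K V) (hW : Module.finrank K W ≤ d + 1) (h : ∀ i ∈ S, v i ∈ W) :
    OnFlat K d v S := by
  obtain ⟨W', h1, h2⟩ := exists_finrank_eq_of_le hd W hW
  exact ⟨W', h2, fun i hi => h1 (h i hi)⟩

theorem le_finrank_of_linearIndependent {n : ℕ} {u : Fin n → V} (hu : LinearIndependent K u)
    {W : Submodule K V} (h : ∀ i, u i ∈ W) : n ≤ Module.finrank K W := by
  have h1 : Submodule.span K (Set.range u) ≤ W := by
    rw [Submodule.span_le]
    rintro _ ⟨i, rfl⟩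
    exact h i
  have h2 := finrank_span_eq_card hu
  rw [Fintype.card_fin] at h2
  rw [← h2]
  exact Submodule.finrank_mono h1

/-- Vectors that do not lie on a common flat of dimension `d` are independent. -/
theorem linearIndependent_of_not_onFlat {ι : Type*} {d : ℕ} (hd : d + 1 ≤ Module.finrank K V)
    {v : ι → V} (t : Fin (d + 2) → ι) (h : ¬ OnFlat K d v (Set.range t)) :
    LinearIndependent K (v ∘ t) := by
  by_contra hli
  apply h
  refine onFlat_of_finrank_le hd (Submodule.span K (Set.range (v ∘ t))) ?_ ?_
  · have h1 := finrank_span_range_le (K := K) (v ∘ t)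
    rw [linearIndependent_iff_card_le_finrank_span, Fintype.card_fin, Set.finrank] at hli
    omega
  · rintro _ ⟨i, rfl⟩
    exact Submodule.subset_span ⟨i, rfl⟩

theorem isCap_mkPoints_iff {n : ℕ} (hn : 3 ≤ n) (hV : 2 ≤ Module.finrank K V) (v : Fin n → V) :
    (∃ h : ∀ i, v i ≠ 0, IsCap (mkPoints K v h)) ↔ IsVecCap K v := by
  constructor
  · rintro ⟨h, hi, hc⟩ i j k hij hik hjk
    have h1 := hc i j k hij hik hjk
    have e : ({mkPoints K v h i, mkPoints K v h j, mkPoints K v h k} :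
        Set (Projectivization K V)) = mkPoints K v h '' Set.range ![i, j, k] := by
      ext p
      simp [eq_comm]
      tauto
    rw [e, LieOnLine, lieOnFlat_mkPoints_iff] at h1
    have := linearIndependent_of_not_onFlat hV _ h1
    convert this using 1
    funext a
    fin_cases a <;> rfl
  · intro hc
    refine ⟨fun i => hc.ne_zero hn i, injective_mkPoints_iff.2 fun i j hij x y => hc.pair hn hij x y,
      ?_⟩
    rintro i j k hij hik hjk ⟨W, hW, hp⟩
    have hm : ∀ l, (mkPoints K v fun i => hc.ne_zero hn i) l ∈
        ({(mkPoints K v fun i => hc.ne_zero hn i) i, (mkPoints K v fun i => hc.ne_zero hn i) j,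
          (mkPoints K v fun i => hc.ne_zero hn i) k} : Set (Projectivization K V)) → v l ∈ W := by
      intro l hl
      have := hp _ hl
      rwa [mkPoints, Projectivization.submodule_mk, Submodule.span_singleton_le_iff_mem] at this
    have := le_finrank_of_linearIndependent (hc i j k hij hik hjk) (W := W) (by
      intro a
      fin_cases a
      · exact hm i (by simp)
      · exact hm j (by simp)
      · exact hm k (by simp))
    omega

/-- Strong realizability in terms of representing vectors. -/
theorem isStrongRealization_mkPoints_iff {F : Type*} [Field F] {n : ℕ} (hn : 2 ≤ n)
    (f : PlanarSpace (Fin n)) (v : Fin n → Fin 4 → F) :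
    (∃ h : ∀ i, v i ≠ 0, f.IsStrongRealization (mkPoints F v h)) ↔
      PairwiseIndep F v ∧
        (∀ S : Finset (Fin n), OnFlat F 1 v (S : Set (Fin n)) ↔ ∃ L ∈ f.lines, S ⊆ L) ∧
        (∀ S : Finset (Fin n), OnFlat F 2 v (S : Set (Fin n)) ↔ ∃ H ∈ f.planes, S ⊆ H) := by
  unfold PlanarSpace.IsStrongRealization LieOnLine LieOnPlane
  simp only [lieOnFlat_mkPoints_iff, injective_mkPoints_iff]
  exact ⟨fun ⟨_, h⟩ => h, fun h => ⟨h.1.ne_zero hn, h⟩⟩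

end ProjectiveCounts

section SkewLines

open Classical Finset

variable {K V : Type*} [Field K] [AddCommGroup V] [Module K V]

theorem linearIndependent_quad_iff {a b c d : V} :
    LinearIndependent K ![a, b, c, d] ↔
      ∀ x y z t : K, x • a + y • b + z • c + t • d = 0 → x = 0 ∧ y = 0 ∧ z = 0 ∧ t = 0 := by
  rw [Fintype.linearIndependent_iff]
  constructor
  · intro h x y z t hxyz
    have := h ![x, y, z, t] (by simpa [Fin.sum_univ_four] using hxyz)
    exact ⟨this 0, this 1, this 2, this 3⟩
  · intro h g hg
    rw [Fin.sum_univ_four] at hg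
    obtain ⟨h0, h1, h2, h3⟩ := h _ _ _ _ hg
    intro i
    fin_cases i <;> assumption

variable (K) in
/-- Pairwise independent vectors, those in `A` and the others lying in two complementary
planes through the origin. -/
def IsSkew {n : ℕ} (A : Finset (Fin n)) (v : Fin n → V) : Prop :=
  PairwiseIndep K v ∧ ∃ W₁ W₂ : Submodule K V, Module.finrank K W₁ = 2 ∧ Module.finrank K W₂ = 2 ∧
    Disjoint W₁ W₂ ∧ (∀ i ∈ A, v i ∈ W₁) ∧ ∀ i ∉ A, v i ∈ W₂

theorem PairwiseIndep.linearIndependent_quad {n : ℕ} {v : Fin n → V} (hv : PairwiseIndep K v)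
    {W₁ W₂ : Submodule K V} (hW : Disjoint W₁ W₂) {i j k l : Fin n} (hi : v i ∈ W₁)
    (hj : v j ∈ W₁) (hk : v k ∈ W₂) (hl : v l ∈ W₂) (hij : i ≠ j) (hkl : k ≠ l) :
    LinearIndependent K ![v i, v j, v k, v l] := by
  rw [linearIndependent_quad_iff]
  intro x y z t h
  have h1 : x • v i + y • v j ∈ W₁ := W₁.add_mem (W₁.smul_mem _ hi) (W₁.smul_mem _ hj)
  have h2 : z • v k + t • v l ∈ W₂ := W₂.add_mem (W₂.smul_mem _ hk) (W₂.smul_mem _ hl)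
  have h3 : x • v i + y • v j = -(z • v k + t • v l) := by
    rw [eq_neg_iff_add_eq_zero, ← h]
    abel
  have h4 : x • v i + y • v j = 0 :=
    Submodule.disjoint_def.1 hW _ h1 (by rw [h3]; exact W₂.neg_mem h2)
  have h5 : z • v k + t • v l = 0 := by
    rw [h4] at h3
    exact neg_eq_zero.1 h3.symm
  obtain ⟨hx, hy⟩ := hv i j hij x y h4
  obtain ⟨hz, ht⟩ := hv k l hkl z t h5
  exact ⟨hx, hy, hz, ht⟩

theorem mem_span_pair_of_finrank_eq_two [FiniteDimensional K V] {a b c : V} {W : Submodule K V}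
    (hW : Module.finrank K W = 2) (ha : a ∈ W) (hb : b ∈ W) (hc : c ∈ W)
    (hab : ∀ x y : K, x • a + y • b = 0 → x = 0 ∧ y = 0) : ∃ x y : K, x • a + y • b = c := by
  have hli : LinearIndependent K ![a, b] := by
    rw [LinearIndependent.pair_iff]
    exact hab
  have h1 : Submodule.span K (Set.range ![a, b]) ≤ W := by
    rw [Submodule.span_le]
    rintro _ ⟨i, rfl⟩
    fin_cases i <;> assumption
  have h2 : Submodule.span K (Set.range ![a, b]) = W := by
    apply Submodule.eq_of_le_of_finrank_eq h1
    rw [finrank_span_eq_card hli, hW, Fintype.card_fin]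
  rw [← h2, Matrix.range_cons, Matrix.range_cons, Matrix.range_empty, Set.union_empty,
    Set.singleton_union, Submodule.mem_span_pair] at hc
  exact hc

theorem PairwiseIndep.onSecant [FiniteDimensional K V] {n : ℕ} {v : Fin n → V}
    (hv : PairwiseIndep K v) {W : Submodule K V} (hW : Module.finrank K W = 2) {i j k : Fin n}
    (hi : v i ∈ W) (hj : v j ∈ W) (hk : v k ∈ W) (hij : i ≠ j) (hik : i ≠ k) (hjk : j ≠ k) :
    OnSecant K (v i) (v j) (v k) := by
  obtain ⟨x, y, h⟩ := mem_span_pair_of_finrank_eq_two hW hi hj hk (hv i j hij)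
  refine ⟨x, y, ?_, ?_, h.symm⟩
  · rintro rfl
    exact one_ne_zero (neg_eq_zero.1 (hv j k hjk y (-1) (by rw [← h]; module)).2)
  · rintro rfl
    exact one_ne_zero (neg_eq_zero.1 (hv i k hik x (-1) (by rw [← h]; module)).2)

/-- A planar space consisting of the points of two skew lines is realized exactly by the points of
two skew lines. -/
theorem isStrongRealization_iff_isSkew {F : Type*} [Field F] {n : ℕ} (f : PlanarSpace (Fin n))
    (A : Finset (Fin n)) (hA : 2 ≤ A.card) (hB : 2 ≤ Aᶜ.card)
    (hlines : ∀ S : Finset (Fin n), (∃ L ∈ f.lines, S ⊆ L) ↔ S ⊆ A ∨ S ⊆ Aᶜ ∨ S.card ≤ 2)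
    (hplanes : ∀ S : Finset (Fin n), (∃ H ∈ f.planes, S ⊆ H) ↔
      (S ∩ A).card ≤ 1 ∨ (S ∩ Aᶜ).card ≤ 1) (v : Fin n → Fin 4 → F) :
    (PairwiseIndep F v ∧
        (∀ S : Finset (Fin n), OnFlat F 1 v (S : Set (Fin n)) ↔ ∃ L ∈ f.lines, S ⊆ L) ∧
        (∀ S : Finset (Fin n), OnFlat F 2 v (S : Set (Fin n)) ↔ ∃ H ∈ f.planes, S ⊆ H)) ↔
      IsSkew F A v := by
  have hdim : Module.finrank F (Fin 4 → F) = 4 := by simp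
  simp only [hlines, hplanes]
  constructor
  · rintro ⟨hv, h1, h2⟩
    obtain ⟨W₁, hW₁, hA₁⟩ := (h1 A).2 (Or.inl (Finset.Subset.refl _))
    obtain ⟨W₂, hW₂, hB₂⟩ := (h1 Aᶜ).2 (Or.inr (Or.inl (Finset.Subset.refl _)))
    refine ⟨hv, W₁, W₂, hW₁, hW₂, ?_, hA₁, fun i hi => hB₂ i (by simpa using hi)⟩
    rw [disjoint_iff]
    by_contra hne
    have hpos : 1 ≤ Module.finrank F (W₁ ⊓ W₂ : Submodule F (Fin 4 → F)) :=
      Nat.one_le_iff_ne_zero.2 fun h0 => hne (Submodule.finrank_eq_zero.1 h0)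
    have hsum := Submodule.finrank_sup_add_finrank_inf_eq W₁ W₂
    have hflat : OnFlat F 2 v ((univ : Finset (Fin n)) : Set (Fin n)) := by
      refine onFlat_of_finrank_le (by rw [hdim]; norm_num) (W₁ ⊔ W₂) (by omega) ?_
      intro i _
      by_cases hi : i ∈ A
      · exact Submodule.mem_sup_left (hA₁ i hi)
      · exact Submodule.mem_sup_right (hB₂ i (by simpa using hi))
    have := (h2 univ).1 hflat
    rw [univ_inter, univ_inter] at this
    omega
  · rintro ⟨hv, W₁, W₂, hW₁, hW₂, hdisj, hA₁, hB₂⟩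
    have hquad : ∀ {i j k l : Fin n}, i ∈ A → j ∈ A → k ∉ A → l ∉ A → i ≠ j → k ≠ l →
        LinearIndependent F ![v i, v j, v k, v l] := fun hi hj hk hl hij hkl =>
      hv.linearIndependent_quad hdisj (hA₁ _ hi) (hA₁ _ hj) (hB₂ _ hk) (hB₂ _ hl) hij hkl
    refine ⟨hv, fun S => ⟨?_, ?_⟩, fun S => ⟨?_, ?_⟩⟩
    · rintro ⟨W, hW, hS⟩
      by_contra hcon
      push Not at hcon
      obtain ⟨hSA, hSB, hS3⟩ := hcon
      obtain ⟨k, hkS, hk⟩ := Finset.not_subset.1 hSA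
      obtain ⟨i, hiS, hi⟩ := Finset.not_subset.1 hSB
      rw [mem_compl, not_not] at hi
      obtain ⟨j, hjS, hj⟩ : ∃ j ∈ S, j ∉ ({i, k} : Finset (Fin n)) :=
        exists_mem_notMem_of_card_lt_card (card_le_two.trans_lt hS3)
      simp only [mem_insert, mem_singleton, not_or] at hj
      by_cases hjA : j ∈ A
      · obtain ⟨l, hl, hlk⟩ : ∃ l ∈ Aᶜ, l ≠ k := exists_mem_ne (by omega) k
        have hq := linearIndependent_quad_iff.1
          (hquad hi hjA hk (by simpa using hl) (Ne.symm hj.1) hlk.symm)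
        have := le_finrank_of_linearIndependent (W := W) (u := ![v i, v j, v k])
          (linearIndependent_triple_iff.2 fun x y z he => by
            have := hq x y z 0 (by rw [← he]; module)
            tauto) (by
            intro a
            fin_cases a
            exacts [hS i hiS, hS j hjS, hS k hkS])
        omega
      · obtain ⟨l, hl, hlk⟩ : ∃ l ∈ A, l ≠ i := exists_mem_ne (by omega) i
        have hq := linearIndependent_quad_iff.1
          (hquad hi hl hk hjA hlk.symm (Ne.symm hj.2))
        have := le_finrank_of_linearIndependent (W := W) (u := ![v i, v k, v j])
          (linearIndependent_triple_iff.2 fun x y z he => by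
            have := hq x 0 y z (by rw [← he]; module)
            tauto) (by
            intro a
            fin_cases a
            exacts [hS i hiS, hS k hkS, hS j hjS])
        omega
    · rintro (h | h | h)
      · exact ⟨W₁, hW₁, fun i hi => hA₁ i (h hi)⟩
      · exact ⟨W₂, hW₂, fun i hi => hB₂ i (by simpa using h hi)⟩
      · refine onFlat_of_finrank_le (by rw [hdim]; norm_num)
          (Submodule.span F (S.image v : Set (Fin 4 → F))) ?_ ?_
        · exact ((finrank_span_finset_le_card _).trans card_image_le).trans h
        · intro i hi
          exact Submodule.subset_span (by
            rw [coe_image]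
            exact Set.mem_image_of_mem v hi)
    · rintro ⟨W, hW, hS⟩
      by_contra hcon
      push Not at hcon
      obtain ⟨i, hi, j, hj, hij⟩ := one_lt_card.1 hcon.1
      obtain ⟨k, hk, l, hl, hkl⟩ := one_lt_card.1 hcon.2
      simp only [mem_inter, mem_compl] at hi hj hk hl
      have := le_finrank_of_linearIndependent (W := W)
        (hquad hi.2 hj.2 hk.2 hl.2 hij hkl) (by
          intro a
          fin_cases a
          exacts [hS i hi.1, hS j hj.1, hS k hk.1, hS l hl.1])
      omega
    · have hgen : ∀ (W : Submodule F (Fin 4 → F)) (B : Finset (Fin n)), Module.finrank F W = 2 →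
          (∀ i ∈ S, i ∉ B → v i ∈ W) → (S ∩ B).card ≤ 1 → OnFlat F 2 v (S : Set (Fin n)) := by
        intro W B hW hmem hcard
        refine onFlat_of_finrank_le (by rw [hdim]; norm_num)
          (W ⊔ Submodule.span F ((S ∩ B).image v : Set (Fin 4 → F))) ?_ ?_
        · have h1 := Submodule.finrank_add_le_finrank_add_finrank W
            (Submodule.span F ((S ∩ B).image v : Set (Fin 4 → F)))
          have h2 := (finrank_span_finset_le_card (R := F) ((S ∩ B).image v)).trans card_image_le
          rw [Set.finrank] at h2
          omega
        · intro i hi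
          by_cases hiB : i ∈ B
          · refine Submodule.mem_sup_right (Submodule.subset_span ?_)
            rw [coe_image]
            exact Set.mem_image_of_mem v (mem_inter.2 ⟨hi, hiB⟩)
          · exact Submodule.mem_sup_left (hmem i hi hiB)
      rintro (h | h)
      · exact hgen W₂ A hW₂ (fun i _ hi => hB₂ i hi) h
      · exact hgen W₁ Aᶜ hW₁ (fun i _ hi => hA₁ i (by simpa using hi)) h

end SkewLines

section SkewCounts

open Classical Finset

theorem hyp6_lines_iff (S : Finset (Fin 6)) :
    (∃ L ∈ PlanarSpace.hyp6.lines, S ⊆ L) ↔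
      S ⊆ {0, 1, 2} ∨ S ⊆ ({0, 1, 2} : Finset (Fin 6))ᶜ ∨ S.card ≤ 2 := by
  revert S
  decide +kernel

theorem hyp6_planes_iff (S : Finset (Fin 6)) :
    (∃ H ∈ PlanarSpace.hyp6.planes, S ⊆ H) ↔
      (S ∩ {0, 1, 2}).card ≤ 1 ∨ (S ∩ ({0, 1, 2} : Finset (Fin 6))ᶜ).card ≤ 1 := by
  revert S
  decide +kernel

theorem h5_lines_iff (S : Finset (Fin 7)) :
    (∃ L ∈ PlanarSpace.h5.lines, S ⊆ L) ↔
      S ⊆ {0, 1, 2, 3} ∨ S ⊆ ({0, 1, 2, 3} : Finset (Fin 7))ᶜ ∨ S.card ≤ 2 := by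
  revert S
  decide +kernel

theorem h5_planes_iff (S : Finset (Fin 7)) :
    (∃ H ∈ PlanarSpace.h5.planes, S ⊆ H) ↔
      (S ∩ {0, 1, 2, 3}).card ≤ 1 ∨ (S ∩ ({0, 1, 2, 3} : Finset (Fin 7))ᶜ).card ≤ 1 := by
  revert S
  decide +kernel

variable {K V : Type*} [Field K] [AddCommGroup V] [Module K V]

theorem isSkew_of_coords {n : ℕ} {A : Finset (Fin n)} {v : Fin n → V} {a b c d : V}
    (hu : LinearIndependent K ![a, b, c, d]) (p q : Fin n → K)
    (hA : ∀ i ∈ A, v i = p i • a + q i • b) (hB : ∀ i ∉ A, v i = p i • c + q i • d)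
    (hne : ∀ i, p i ≠ 0 ∨ q i ≠ 0)
    (hdet : ∀ i j, i ≠ j → (i ∈ A ↔ j ∈ A) → p i * q j - q i * p j ≠ 0) : IsSkew K A v := by
  rw [linearIndependent_quad_iff] at hu
  have hab : ∀ x y : K, x • a + y • b = 0 → x = 0 ∧ y = 0 := fun x y h => by
    have := hu x y 0 0 (by rw [← h]; module)
    tauto
  have hcd : ∀ x y : K, x • c + y • d = 0 → x = 0 ∧ y = 0 := fun x y h => by
    have := hu 0 0 x y (by rw [← h]; module)
    tauto
  have hcancel : ∀ i, ∀ x : K, x * p i = 0 → x * q i = 0 → x = 0 := by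
    intro i x h1 h2
    rcases hne i with h | h
    · exact (mul_eq_zero.1 h1).resolve_right h
    · exact (mul_eq_zero.1 h2).resolve_right h
  have hplane : ∀ a b : V, (∀ x y : K, x • a + y • b = 0 → x = 0 ∧ y = 0) → ∀ i j, i ≠ j →
      (i ∈ A ↔ j ∈ A) → ∀ x y : K, x • (p i • a + q i • b) + y • (p j • a + q j • b) = 0 →
      x = 0 ∧ y = 0 := by
    intro a b hab i j hij hA x y h
    obtain ⟨h1, h2⟩ := hab (x * p i + y * p j) (x * q i + y * q j) (by
      linear_combination (norm := module) h)
    have hd := hdet i j hij hA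
    constructor
    · exact (mul_eq_zero.1 (show x * (p i * q j - q i * p j) = 0 by
        linear_combination q j * h1 - p j * h2)).resolve_right hd
    · exact (mul_eq_zero.1 (show y * (p i * q j - q i * p j) = 0 by
        linear_combination p i * h2 - q i * h1)).resolve_right hd
  refine ⟨?_, Submodule.span K {a, b}, Submodule.span K {c, d}, ?_, ?_, ?_, ?_, ?_⟩
  · intro i j hij x y h
    by_cases hi : i ∈ A <;> by_cases hj : j ∈ A
    · rw [hA i hi, hA j hj] at h
      exact hplane a b hab i j hij (by tauto) x y h
    · rw [hA i hi, hB j hj] at h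
      obtain ⟨h1, h2, h3, h4⟩ := hu (x * p i) (x * q i) (y * p j) (y * q j) (by
        linear_combination (norm := module) h)
      exact ⟨hcancel i x h1 h2, hcancel j y h3 h4⟩
    · rw [hB i hi, hA j hj] at h
      obtain ⟨h1, h2, h3, h4⟩ := hu (y * p j) (y * q j) (x * p i) (x * q i) (by
        linear_combination (norm := module) h)
      exact ⟨hcancel i x h3 h4, hcancel j y h1 h2⟩
    · rw [hB i hi, hB j hj] at h
      exact hplane c d hcd i j hij (by tauto) x y h
  · have := finrank_span_eq_card (LinearIndependent.pair_iff.2 hab)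
    rwa [Matrix.range_cons, Matrix.range_cons, Matrix.range_empty, Set.union_empty,
      Set.singleton_union, Fintype.card_fin] at this
  · have := finrank_span_eq_card (LinearIndependent.pair_iff.2 hcd)
    rwa [Matrix.range_cons, Matrix.range_cons, Matrix.range_empty, Set.union_empty,
      Set.singleton_union, Fintype.card_fin] at this
  · rw [Submodule.disjoint_def]
    intro w h1 h2
    obtain ⟨x, y, rfl⟩ := Submodule.mem_span_pair.1 h1
    obtain ⟨z, t, h⟩ := Submodule.mem_span_pair.1 h2
    obtain ⟨hx, hy, -⟩ := hu x y (-z) (-t) (by linear_combination (norm := module) -h)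
    rw [hx, hy]
    module
  · intro i hi
    rw [hA i hi]
    exact Submodule.mem_span_pair.2 ⟨_, _, rfl⟩
  · intro i hi
    rw [hB i hi]
    exact Submodule.mem_span_pair.2 ⟨_, _, rfl⟩

variable [Fintype V] [Fintype K]

theorem card_isSkew_three_three :
    ((univ.filter fun v : Fin 6 → V => IsSkew K {0, 1, 2} v).card : ℤ) =
      linIndepCard K V 4 * (Fintype.card K - 1) ^ 4 := by
  rw [linIndepCard, ← card_pi_ne_zero, ← Nat.cast_mul, ← card_product]
  congr 1
  symm
  refine Finset.card_bij (fun x _ => ![x.1 0, x.1 1, x.2 0 • x.1 0 + x.2 1 • x.1 1, x.1 2, x.1 3,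
    x.2 2 • x.1 2 + x.2 3 • x.1 3]) ?_ ?_ ?_
  · rintro ⟨u, c⟩ h
    simp only [mem_product, mem_filter, mem_univ, true_and] at h
    obtain ⟨hu, hc⟩ := h
    have hu' : LinearIndependent K ![u 0, u 1, u 2, u 3] := by
      convert hu using 1
      funext i
      fin_cases i <;> rfl
    have h0 := hc 0
    have h1 := hc 1
    have h2 := hc 2
    have h3 := hc 3
    refine mem_filter.2 ⟨mem_univ _, isSkew_of_coords hu' ![1, 0, c 0, 1, 0, c 2]
      ![0, 1, c 1, 0, 1, c 3] ?_ ?_ ?_ ?_⟩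
    · intro i hi
      fin_cases i <;> first | exact absurd hi (by decide) | simp
    · intro i hi
      fin_cases i <;> first | exact absurd hi (by decide) | simp
    · intro i
      fin_cases i <;> simp [h0, h2]
    · intro i j hij hA
      fin_cases i <;> fin_cases j <;> first
        | exact absurd rfl hij
        | exact absurd hA (by decide)
        | simp [h0, h1, h2, h3]
  · rintro ⟨u, c⟩ h ⟨u', c'⟩ _ e
    simp only [mem_product, mem_filter, mem_univ, true_and] at h
    have e0 : u 0 = u' 0 := congr_fun e 0
    have e1 : u 1 = u' 1 := congr_fun e 1
    have e2 : c 0 • u 0 + c 1 • u 1 = c' 0 • u' 0 + c' 1 • u' 1 := congr_fun e 2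
    have e3 : u 2 = u' 2 := congr_fun e 3
    have e4 : u 3 = u' 3 := congr_fun e 4
    have e5 : c 2 • u 2 + c 3 • u 3 = c' 2 • u' 2 + c' 3 • u' 3 := congr_fun e 5
    have hu : u = u' := by
      funext i
      fin_cases i <;> assumption
    subst hu
    have := Fintype.linearIndependent_iff.1 h.1 (fun i => c i - c' i) (by
      rw [Fin.sum_univ_four]
      linear_combination (norm := module) e2 + e5)
    refine Prod.ext rfl ?_
    funext i
    exact sub_eq_zero.1 (this i)
  · intro v hv
    obtain ⟨hp, W₁, W₂, hW₁, hW₂, hd, h1, h2⟩ := (mem_filter.1 hv).2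
    have hli := hp.linearIndependent_quad hd (h1 0 (by decide)) (h1 1 (by decide))
      (h2 3 (by decide)) (h2 4 (by decide)) (by decide) (by decide)
    obtain ⟨x, y, hx, hy, hxy⟩ := hp.onSecant hW₁ (h1 0 (by decide)) (h1 1 (by decide))
      (h1 2 (by decide)) (by decide) (by decide) (by decide)
    obtain ⟨z, t, hz, ht, hzt⟩ := hp.onSecant hW₂ (h2 3 (by decide)) (h2 4 (by decide))
      (h2 5 (by decide)) (by decide) (by decide) (by decide)
    refine ⟨(![v 0, v 1, v 3, v 4], ![x, y, z, t]), ?_, ?_⟩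
    · simp only [mem_product, mem_filter, mem_univ, true_and]
      refine ⟨hli, fun i => ?_⟩
      fin_cases i <;> assumption
    · funext i
      fin_cases i
      exacts [rfl, rfl, hxy.symm, rfl, rfl, hzt.symm]

theorem card_isSkew_four_three :
    ((univ.filter fun v : Fin 7 → V => IsSkew K {0, 1, 2, 3} v).card : ℤ) =
      linIndepCard K V 4 * ((Fintype.card K - 1) ^ 5 * (Fintype.card K - 2)) := by
  rw [linIndepCard, ← card_pi_ne_zero, ← card_filter_ne_zero_ne_one, ← Nat.cast_mul,
    ← Nat.cast_mul, ← card_product, ← card_product]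
  congr 1
  symm
  refine Finset.card_bij (fun x _ => ![x.1 0, x.1 1, x.2.1 0 • x.1 0 + x.2.1 1 • x.1 1,
    (x.2.1 4 * x.2.1 0) • x.1 0 + (x.2.1 4 * x.2.2 * x.2.1 1) • x.1 1, x.1 2, x.1 3,
    x.2.1 2 • x.1 2 + x.2.1 3 • x.1 3]) ?_ ?_ ?_
  · rintro ⟨u, c, k⟩ h
    simp only [mem_product, mem_filter, mem_univ, true_and] at h
    obtain ⟨hu, hc, hk⟩ := h
    have hu' : LinearIndependent K ![u 0, u 1, u 2, u 3] := by
      convert hu using 1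
      funext i
      fin_cases i <;> rfl
    have h0 := hc 0
    have h1 := hc 1
    have h2 := hc 2
    have h3 := hc 3
    have h4 := hc 4
    have hk1 : c 0 * (c 4 * k * c 1) - c 1 * (c 4 * c 0) ≠ 0 := by
      rw [show c 0 * (c 4 * k * c 1) - c 1 * (c 4 * c 0) = c 0 * c 1 * c 4 * (k - 1) by ring]
      exact mul_ne_zero (mul_ne_zero (mul_ne_zero h0 h1) h4) (sub_ne_zero.2 hk.2)
    have hk2 : c 4 * c 0 * c 1 - c 4 * k * c 1 * c 0 ≠ 0 := by
      rw [show c 4 * c 0 * c 1 - c 4 * k * c 1 * c 0 = -(c 0 * c 1 * c 4 * (k - 1)) by ring]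
      exact neg_ne_zero.2 (mul_ne_zero (mul_ne_zero (mul_ne_zero h0 h1) h4) (sub_ne_zero.2 hk.2))
    refine mem_filter.2 ⟨mem_univ _, isSkew_of_coords hu' ![1, 0, c 0, c 4 * c 0, 1, 0, c 2]
      ![0, 1, c 1, c 4 * k * c 1, 0, 1, c 3] ?_ ?_ ?_ ?_⟩
    · intro i hi
      fin_cases i <;> first | exact absurd hi (by decide) | simp
    · intro i hi
      fin_cases i <;> first | exact absurd hi (by decide) | simp
    · intro i
      fin_cases i <;> simp [h0, h2, h4]
    · intro i j hij hA
      fin_cases i <;> fin_cases j <;> first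
        | exact absurd rfl hij
        | exact absurd hA (by decide)
        | exact hk1
        | exact hk2
        | simp [h0, h1, h2, h3, h4, hk.1]
  · rintro ⟨u, c, k⟩ h ⟨u', c', k'⟩ h' e
    simp only [mem_product, mem_filter, mem_univ, true_and] at h h'
    have e0 : u 0 = u' 0 := congr_fun e 0
    have e1 : u 1 = u' 1 := congr_fun e 1
    have e2 : c 0 • u 0 + c 1 • u 1 = c' 0 • u' 0 + c' 1 • u' 1 := congr_fun e 2
    have e3 : (c 4 * c 0) • u 0 + (c 4 * k * c 1) • u 1 =
      (c' 4 * c' 0) • u' 0 + (c' 4 * k' * c' 1) • u' 1 := congr_fun e 3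
    have e4 : u 2 = u' 2 := congr_fun e 4
    have e5 : u 3 = u' 3 := congr_fun e 5
    have e6 : c 2 • u 2 + c 3 • u 3 = c' 2 • u' 2 + c' 3 • u' 3 := congr_fun e 6
    have hu : u = u' := by
      funext i
      fin_cases i <;> assumption
    subst hu
    have hli := Fintype.linearIndependent_iff.1 h.1
    have h4 := hli ![c 0 - c' 0, c 1 - c' 1, c 2 - c' 2, c 3 - c' 3] (by
      rw [Fin.sum_univ_four]
      simp only [Matrix.cons_val]
      linear_combination (norm := module) e2 + e6)
    have h5 := hli ![c 4 * c 0 - c' 4 * c' 0, c 4 * k * c 1 - c' 4 * k' * c' 1, 0, 0] (by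
      rw [Fin.sum_univ_four]
      simp only [Matrix.cons_val]
      linear_combination (norm := module) e3)
    have f0 : c 0 = c' 0 := sub_eq_zero.1 (h4 0)
    have f1 : c 1 = c' 1 := sub_eq_zero.1 (h4 1)
    have f2 : c 2 = c' 2 := sub_eq_zero.1 (h4 2)
    have f3 : c 3 = c' 3 := sub_eq_zero.1 (h4 3)
    have g0 : c 4 * c 0 = c' 4 * c' 0 := sub_eq_zero.1 (h5 0)
    have g1 : c 4 * k * c 1 = c' 4 * k' * c' 1 := sub_eq_zero.1 (h5 1)
    have f4 : c 4 = c' 4 := by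
      rw [← f0] at g0
      exact mul_right_cancel₀ (h.2.1 0) g0
    have fk : k = k' := by
      rw [← f1, ← f4] at g1
      exact mul_left_cancel₀ (h.2.1 4) (mul_right_cancel₀ (h.2.1 1) g1)
    have hc : c = c' := by
      funext i
      fin_cases i <;> assumption
    rw [hc, fk]
  · intro v hv
    obtain ⟨hp, W₁, W₂, hW₁, hW₂, hd, h1, h2⟩ := (mem_filter.1 hv).2
    have hli := hp.linearIndependent_quad hd (h1 0 (by decide)) (h1 1 (by decide))
      (h2 4 (by decide)) (h2 5 (by decide)) (by decide) (by decide)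
    obtain ⟨x, y, hx, hy, hxy⟩ := hp.onSecant hW₁ (h1 0 (by decide)) (h1 1 (by decide))
      (h1 2 (by decide)) (by decide) (by decide) (by decide)
    obtain ⟨x', y', hx', hy', hxy'⟩ := hp.onSecant hW₁ (h1 0 (by decide)) (h1 1 (by decide))
      (h1 3 (by decide)) (by decide) (by decide) (by decide)
    obtain ⟨z, t, hz, ht, hzt⟩ := hp.onSecant hW₂ (h2 4 (by decide)) (h2 5 (by decide))
      (h2 6 (by decide)) (by decide) (by decide) (by decide)
    refine ⟨(![v 0, v 1, v 4, v 5], ![x, y, z, t, x' / x], (y' * x) / (x' * y)), ?_, ?_⟩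
    · simp only [mem_product, mem_filter, mem_univ, true_and]
      refine ⟨hli, fun i => ?_, div_ne_zero (mul_ne_zero hy' hx) (mul_ne_zero hx' hy), ?_⟩
      · fin_cases i
        exacts [hx, hy, hz, ht, div_ne_zero hx' hx]
      · intro h
        rw [div_eq_one_iff_eq (mul_ne_zero hx' hy)] at h
        have := hp 2 3 (by decide) x' (-x) (by
          rw [hxy, hxy']
          have : (x' * y - x * y') • v 1 = 0 := by
            rw [show x' * y - x * y' = 0 by linear_combination -h, zero_smul]
          linear_combination (norm := module) this)
        exact hx' this.1
    · funext i
      fin_cases i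
      · rfl
      · rfl
      · exact hxy.symm
      · change (x' / x * x) • v 0 + (x' / x * (y' * x / (x' * y)) * y) • v 1 = v 3
        rw [hxy', show x' / x * x = x' by field_simp,
          show x' / x * (y' * x / (x' * y)) * y = y' by field_simp]
      · rfl
      · rfl
      · exact hzt.symm

end SkewCounts

section Fano

open Classical Finset

/-- The lines of the Fano plane. -/
def fanoLines : Finset (Finset (Fin 7)) :=
  {{0, 1, 2}, {0, 3, 4}, {0, 5, 6}, {1, 3, 5}, {1, 4, 6}, {2, 3, 6}, {2, 4, 5}}

theorem h6_lines : PlanarSpace.h6.lines = fanoLines := by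
  decide +kernel

theorem h6_planes (S : Finset (Fin 7)) : ∃ H ∈ PlanarSpace.h6.planes, S ⊆ H :=
  ⟨univ, by decide +kernel, subset_univ _⟩

theorem exists_fanoLine_of_closed (T : Finset (Fin 7))
    (hT : ∀ L ∈ fanoLines, ∀ k ∈ L, L.erase k ⊆ T → k ∈ T) :
    T = univ ∨ ∃ L ∈ fanoLines, T ⊆ L := by
  revert T
  decide +kernel

theorem exists_off_fanoLine (i j : Fin 7) (hij : i ≠ j) :
    ∃ k, ∀ L ∈ fanoLines, ¬ (i ∈ L ∧ j ∈ L ∧ k ∈ L) := by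
  revert i j
  decide +kernel

theorem fanoLine_erase (L : Finset (Fin 7)) (hL : L ∈ fanoLines) :
    ∃ i ∈ L, ∃ j ∈ L, ∀ k ∈ L, k = i ∨ k = j ∨ L.erase k = {i, j} := by
  revert L
  decide +kernel

variable {K V : Type*} [Field K] [AddCommGroup V] [Module K V]

/-- Representatives of the points of a Fano plane in the plane spanned by `e`. -/
def fanoPoints (e : Fin 3 → V) : Fin 7 → V :=
  ![e 0, e 1, e 0 + e 1, e 2, e 0 + e 2, e 1 + e 2, e 0 + e 1 + e 2]

/-- The points of a Fano plane, represented by arbitrary vectors. -/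
def fanoVectors (e : Fin 3 → V) (c : Fin 6 → K) : Fin 7 → V :=
  ![c 0 • e 0, c 1 • e 1, c 2 • (e 0 + e 1), c 3 • e 2, c 4 • (e 0 + e 2), c 5 • (e 1 + e 2),
    e 0 + e 1 + e 2]

variable (K) in
/-- The vectors represent the points of a Fano plane. -/
def IsFanoFamily (v : Fin 7 → V) : Prop :=
  ∃ (e : Fin 3 → V) (c : Fin 6 → K), LinearIndependent K e ∧ (∀ i, c i ≠ 0) ∧ v = fanoVectors e c

theorem sum_fanoPoints (h2 : (2 : K) = 0) (e : Fin 3 → V) (L : Finset (Fin 7))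
    (hL : L ∈ fanoLines) : ∑ i ∈ L, fanoPoints e i = 0 := by
  have h : ∀ x : V, x + x = 0 := fun x => by rw [← two_smul K, h2, zero_smul]
  have h0 := h (e 0)
  have h1 := h (e 1)
  have h2 := h (e 2)
  have hs : ∀ a b c : Fin 7, a ≠ b → a ≠ c → b ≠ c →
      ∑ i ∈ ({a, b, c} : Finset (Fin 7)), fanoPoints e i =
        fanoPoints e a + fanoPoints e b + fanoPoints e c := by
    intro a b c hab hac hbc
    rw [sum_insert (by simp [hab, hac]), sum_insert (by simp [hbc]), sum_singleton, add_assoc]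
  simp only [fanoLines, mem_insert, mem_singleton] at hL
  rcases hL with rfl | rfl | rfl | rfl | rfl | rfl | rfl <;>
    rw [hs _ _ _ (by decide) (by decide) (by decide)] <;>
    simp only [fanoPoints, Matrix.cons_val]
  · linear_combination (norm := module) h0 + h1
  · linear_combination (norm := module) h0 + h2
  · linear_combination (norm := module) h0 + h1 + h2
  · linear_combination (norm := module) h1 + h2
  · linear_combination (norm := module) h0 + h1 + h2
  · linear_combination (norm := module) h0 + h1 + h2
  · linear_combination (norm := module) h0 + h1 + h2

theorem fanoPoints_subset_line (h2 : (2 : K) = 0) {e : Fin 3 → V} (he : LinearIndependent K e)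
    {W : Submodule K V} [FiniteDimensional K V] (hW : Module.finrank K W ≤ 2) :
    (univ.filter fun i => fanoPoints e i ∈ W) ≠ univ ∧
      ∃ L ∈ fanoLines, (univ.filter fun i => fanoPoints e i ∈ W) ⊆ L := by
  have hne : (univ.filter fun i => fanoPoints e i ∈ W) ≠ univ := by
    intro h
    have hm : ∀ i, fanoPoints e i ∈ W := fun i => by
      have := mem_univ i
      rw [← h, mem_filter] at this
      exact this.2
    have := le_finrank_of_linearIndependent he (W := W) (by
      intro i
      fin_cases i
      exacts [hm 0, hm 1, hm 3])
    omega
  refine ⟨hne, (exists_fanoLine_of_closed _ ?_).resolve_left hne⟩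
  intro L hL k hk hs
  have hsum := sum_fanoPoints h2 e L hL
  rw [← add_sum_erase _ _ hk] at hsum
  rw [mem_filter]
  refine ⟨mem_univ _, ?_⟩
  rw [eq_neg_of_add_eq_zero_left hsum]
  refine W.neg_mem (W.sum_mem fun i hi => ?_)
  exact (mem_filter.1 (hs hi)).2

theorem fanoVectors_eq (e : Fin 3 → V) (c : Fin 6 → K) (i : Fin 7) :
    fanoVectors e c i = (Fin.snoc c 1 : Fin 7 → K) i • fanoPoints e i := by
  fin_cases i
  · rfl
  · rfl
  · rfl
  · rfl
  · rfl
  · rfl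
  · exact (one_smul K _).symm

theorem fanoVectors_mem_iff {e : Fin 3 → V} {c : Fin 6 → K} (hc : ∀ i, c i ≠ 0)
    (W : Submodule K V) (i : Fin 7) : fanoVectors e c i ∈ W ↔ fanoPoints e i ∈ W := by
  rw [fanoVectors_eq, Submodule.smul_mem_iff]
  induction i using Fin.lastCases with
  | last =>
    rw [Fin.snoc_last]
    exact one_ne_zero
  | cast i => simpa using hc i

/-- In characteristic two, every Fano plane in a plane is a strong realization of `h6`. -/
theorem isStrongRealization_fanoVectors {F : Type*} [Field F] (h2 : (2 : F) = 0)
    {e : Fin 3 → Fin 4 → F} (he : LinearIndependent F e) {c : Fin 6 → F} (hc : ∀ i, c i ≠ 0) :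
    PairwiseIndep F (fanoVectors e c) ∧
      (∀ S : Finset (Fin 7), OnFlat F 1 (fanoVectors e c) (S : Set (Fin 7)) ↔
        ∃ L ∈ PlanarSpace.h6.lines, S ⊆ L) ∧
      (∀ S : Finset (Fin 7), OnFlat F 2 (fanoVectors e c) (S : Set (Fin 7)) ↔
        ∃ H ∈ PlanarSpace.h6.planes, S ⊆ H) := by
  have hdim : Module.finrank F (Fin 4 → F) = 4 := by simp
  have hmem := fun W i => fanoVectors_mem_iff (e := e) hc W i
  rw [h6_lines]
  have hdep : ∀ i j, i ≠ j → ∀ x y : F,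
      x • fanoVectors e c i + y • fanoVectors e c j = 0 → y = 0 := by
    intro i j hij x y h
    by_contra hy
    obtain ⟨k, hk⟩ := exists_off_fanoLine i j hij
    have hW : Module.finrank F (Submodule.span F (Set.range ![fanoVectors e c i,
        fanoVectors e c k])) ≤ 2 := finrank_span_range_le _
    set W := Submodule.span F (Set.range ![fanoVectors e c i, fanoVectors e c k])
    have hi : fanoVectors e c i ∈ W := Submodule.subset_span ⟨0, rfl⟩
    have hk' : fanoVectors e c k ∈ W := Submodule.subset_span ⟨1, rfl⟩
    have hj : fanoVectors e c j ∈ W := by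
      rw [← Submodule.smul_mem_iff _ hy, eq_neg_of_add_eq_zero_right h]
      exact W.neg_mem (W.smul_mem _ hi)
    obtain ⟨-, L, hL, hs⟩ := fanoPoints_subset_line h2 he hW
    refine hk L hL ⟨hs ?_, hs ?_, hs ?_⟩
    · exact mem_filter.2 ⟨mem_univ _, (hmem W i).1 hi⟩
    · exact mem_filter.2 ⟨mem_univ _, (hmem W j).1 hj⟩
    · exact mem_filter.2 ⟨mem_univ _, (hmem W k).1 hk'⟩
  refine ⟨fun i j hij x y h => ⟨hdep j i hij.symm y x (by rw [← h]; abel), hdep i j hij x y h⟩,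
    fun S => ⟨?_, ?_⟩, fun S => ⟨fun _ => h6_planes S, fun _ => ?_⟩⟩
  · rintro ⟨W, hW, hS⟩
    obtain ⟨-, L, hL, hs⟩ := fanoPoints_subset_line h2 he hW.le
    exact ⟨L, hL, fun i hi => hs (mem_filter.2 ⟨mem_univ _, (hmem W i).1 (hS i hi)⟩)⟩
  · rintro ⟨L, hL, hSL⟩
    obtain ⟨i, hi, j, hj, hij⟩ := fanoLine_erase L hL
    refine onFlat_of_finrank_le (by rw [hdim]; norm_num)
      (Submodule.span F (Set.range ![fanoPoints e i, fanoPoints e j])) (finrank_span_range_le _) ?_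
    intro k hk
    rw [hmem]
    have hi' : fanoPoints e i ∈ Submodule.span F (Set.range ![fanoPoints e i, fanoPoints e j]) :=
      Submodule.subset_span ⟨0, rfl⟩
    have hj' : fanoPoints e j ∈ Submodule.span F (Set.range ![fanoPoints e i, fanoPoints e j]) :=
      Submodule.subset_span ⟨1, rfl⟩
    rcases hij k (hSL hk) with rfl | rfl | hk'
    · exact hi'
    · exact hj'
    · have hsum := sum_fanoPoints h2 e L hL
      rw [← add_sum_erase _ _ (hSL hk), hk'] at hsum
      rw [eq_neg_of_add_eq_zero_left hsum]
      refine Submodule.neg_mem _ (Submodule.sum_mem _ fun l hl => ?_)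
      rw [mem_insert, mem_singleton] at hl
      rcases hl with rfl | rfl
      · exact hi'
      · exact hj'
  · refine onFlat_of_finrank_le (by rw [hdim]; norm_num) (Submodule.span F (Set.range e))
      (finrank_span_range_le _) fun i _ => ?_
    have hm : ∀ i, e i ∈ Submodule.span F (Set.range e) := fun i => Submodule.subset_span ⟨i, rfl⟩
    rw [hmem]
    have h01 := Submodule.add_mem _ (hm 0) (hm 1)
    fin_cases i
    exacts [hm 0, hm 1, h01, hm 2, Submodule.add_mem _ (hm 0) (hm 2),
      Submodule.add_mem _ (hm 1) (hm 2), Submodule.add_mem _ h01 (hm 2)]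

/-- Every strong realization of `h6` is a Fano plane, and the characteristic is two. -/
theorem isFanoFamily_of_isStrongRealization {F : Type*} [Field F] {v : Fin 7 → Fin 4 → F}
    (hp : PairwiseIndep F v)
    (hl : ∀ S : Finset (Fin 7), OnFlat F 1 v (S : Set (Fin 7)) ↔
        ∃ L ∈ PlanarSpace.h6.lines, S ⊆ L) :
    (2 : F) = 0 ∧ IsFanoFamily F v := by
  rw [h6_lines] at hl
  have hsec : ∀ i j k : Fin 7, i ≠ j → i ≠ k → j ≠ k → ({i, j, k} : Finset (Fin 7)) ∈ fanoLines →
      OnSecant F (v i) (v j) (v k) := by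
    intro i j k hij hik hjk hL
    obtain ⟨W, hW, hm⟩ := (hl {i, j, k}).2 ⟨_, hL, Subset.refl _⟩
    exact hp.onSecant hW (hm i (by simp)) (hm j (by simp)) (hm k (by simp)) hij hik hjk
  have hli : LinearIndependent F ![v 0, v 1, v 3] := by
    have hnot : ¬ OnFlat F 1 v (Set.range ![(0 : Fin 7), 1, 3]) := by
      have e1 : Set.range ![(0 : Fin 7), 1, 3] = (({0, 1, 3} : Finset (Fin 7)) : Set (Fin 7)) := by
        ext x
        simp
        tauto
      rw [e1, hl]
      decide +kernel
    have := linearIndependent_of_not_onFlat (by simp) _ hnot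
    have e1 : v ∘ ![(0 : Fin 7), 1, 3] = ![v 0, v 1, v 3] := by
      funext i
      fin_cases i <;> rfl
    rwa [e1] at this
  rw [linearIndependent_triple_iff] at hli
  obtain ⟨a2, b2, ha2, hb2, h012⟩ := hsec 0 1 2 (by decide) (by decide) (by decide) (by decide)
  obtain ⟨a4, b4, ha4, hb4, h034⟩ := hsec 0 3 4 (by decide) (by decide) (by decide) (by decide)
  obtain ⟨a5, b5, ha5, hb5, h135⟩ := hsec 1 3 5 (by decide) (by decide) (by decide) (by decide)
  obtain ⟨x, y, hx, hy, h056⟩ := hsec 0 5 6 (by decide) (by decide) (by decide) (by decide)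
  obtain ⟨s, t, hs, ht, h146⟩ := hsec 1 4 6 (by decide) (by decide) (by decide) (by decide)
  obtain ⟨s', t', hs', ht', h236⟩ := hsec 2 3 6 (by decide) (by decide) (by decide) (by decide)
  obtain ⟨m, k, hm, hk, h245⟩ := hsec 2 4 5 (by decide) (by decide) (by decide) (by decide)
  rw [h135] at h056
  rw [h034] at h146
  rw [h012] at h236
  rw [h012, h034, h135] at h245
  obtain ⟨i1, i2, i3⟩ := hli (x - t * a4) (y * a5 - s) (y * b5 - t * b4) (by
    linear_combination (norm := module) h146 - h056)
  obtain ⟨j1, j2, j3⟩ := hli (x - s' * a2) (y * a5 - s' * b2) (y * b5 - t') (by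
    linear_combination (norm := module) h236 - h056)
  obtain ⟨k1, k2, k3⟩ := hli (m * a2 + k * a4) (m * b2 - a5) (k * b4 - b5) (by
    linear_combination (norm := module) -h245)
  refine ⟨?_, ![x • v 0, (y * a5) • v 1, (y * b5) • v 3],
    ![x⁻¹, (y * a5)⁻¹, s'⁻¹, (y * b5)⁻¹, t⁻¹, y⁻¹], ?_, ?_, ?_⟩
  · have hst : (m * t + k * s') * x = 0 := by
      linear_combination s' * t * k1 + m * t * j1 + k * s' * i1
    have h3 : m * t + k * s' = 0 := (mul_eq_zero.1 hst).resolve_right hx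
    have h4 : s' * t * (b2 * b4) * m * 2 = 0 := by
      have e1 : m * b2 = a5 := sub_eq_zero.1 k2
      have e2 : k * b4 = b5 := sub_eq_zero.1 k3
      have e3 : y * a5 = s' * b2 := sub_eq_zero.1 j2
      have e4 : y * b5 = t * b4 := sub_eq_zero.1 i3
      have e5 : a5 * b5 * y = m * b2 * t * b4 := by rw [e1]; linear_combination a5 * e4
      have e6 : a5 * b5 * y = k * b4 * s' * b2 := by rw [e2]; linear_combination b5 * e3
      linear_combination s' * (e6 - e5) + b2 * b4 * s' * h3
    have h5 : s' * t * (b2 * b4) * m ≠ 0 :=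
      mul_ne_zero (mul_ne_zero (mul_ne_zero hs' ht) (mul_ne_zero hb2 hb4)) hm
    exact (mul_eq_zero.1 h4).resolve_left h5
  · rw [linearIndependent_triple_iff]
    intro p q r h
    obtain ⟨h1, h2, h3⟩ := hli (p * x) (q * (y * a5)) (r * (y * b5)) (by
      linear_combination (norm := module) h)
    exact ⟨(mul_eq_zero.1 h1).resolve_right hx,
      (mul_eq_zero.1 h2).resolve_right (mul_ne_zero hy ha5),
      (mul_eq_zero.1 h3).resolve_right (mul_ne_zero hy hb5)⟩
  · intro i
    fin_cases i
    exacts [inv_ne_zero hx, inv_ne_zero (mul_ne_zero hy ha5), inv_ne_zero hs',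
      inv_ne_zero (mul_ne_zero hy hb5), inv_ne_zero ht, inv_ne_zero hy]
  · funext i
    fin_cases i
    · change v 0 = x⁻¹ • x • v 0
      rw [inv_smul_smul₀ hx]
    · change v 1 = (y * a5)⁻¹ • (y * a5) • v 1
      rw [inv_smul_smul₀ (mul_ne_zero hy ha5)]
    · change v 2 = s'⁻¹ • (x • v 0 + (y * a5) • v 1)
      rw [h012, eq_inv_smul_iff₀ hs', sub_eq_zero.1 j1, sub_eq_zero.1 j2]
      module
    · change v 3 = (y * b5)⁻¹ • (y * b5) • v 3
      rw [inv_smul_smul₀ (mul_ne_zero hy hb5)]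
    · change v 4 = t⁻¹ • (x • v 0 + (y * b5) • v 3)
      rw [h034, eq_inv_smul_iff₀ ht, sub_eq_zero.1 i1, sub_eq_zero.1 i3]
      module
    · change v 5 = y⁻¹ • ((y * a5) • v 1 + (y * b5) • v 3)
      rw [h135, eq_inv_smul_iff₀ hy]
      module
    · change v 6 = x • v 0 + (y * a5) • v 1 + (y * b5) • v 3
      rw [h056]
      module

variable [Fintype V] [Fintype K]

theorem card_fanoVectors :
    ((univ.filter fun v : Fin 7 → V => IsFanoFamily K v).card : ℤ) =
      linIndepCard K V 3 * (Fintype.card K - 1) ^ 6 := by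
  rw [linIndepCard, ← card_pi_ne_zero, ← Nat.cast_mul, ← card_product]
  congr 1
  symm
  refine Finset.card_bij (fun x _ => fanoVectors x.1 x.2) ?_ ?_ ?_
  · rintro ⟨e, c⟩ h
    simp only [mem_product, mem_filter, mem_univ, true_and] at h ⊢
    exact ⟨e, c, h.1, h.2, rfl⟩
  · rintro ⟨e, c⟩ h ⟨e', c'⟩ h' he
    simp only [mem_product, mem_filter, mem_univ, true_and] at h h'
    obtain ⟨hli, hc⟩ := h
    obtain ⟨-, hc'⟩ := h'
    rw [Fintype.linearIndependent_iff] at hli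
    have e0 : c 0 • e 0 = c' 0 • e' 0 := congr_fun he 0
    have e1 : c 1 • e 1 = c' 1 • e' 1 := congr_fun he 1
    have e2 : c 2 • (e 0 + e 1) = c' 2 • (e' 0 + e' 1) := congr_fun he 2
    have e3 : c 3 • e 2 = c' 3 • e' 2 := congr_fun he 3
    have e4 : c 4 • (e 0 + e 2) = c' 4 • (e' 0 + e' 2) := congr_fun he 4
    have e5 : c 5 • (e 1 + e 2) = c' 5 • (e' 1 + e' 2) := congr_fun he 5
    have e6 : e 0 + e 1 + e 2 = e' 0 + e' 1 + e' 2 := congr_fun he 6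
    have hz := hli ![c' 0 * c' 1 * c' 3 - c' 1 * c' 3 * c 0, c' 0 * c' 1 * c' 3 - c' 0 * c' 3 * c 1,
      c' 0 * c' 1 * c' 3 - c' 0 * c' 1 * c 3] (by
      rw [Fin.sum_univ_three]
      simp only [Matrix.cons_val]
      linear_combination (norm := module) (c' 0 * c' 1 * c' 3) • e6 - (c' 1 * c' 3) • e0 -
        (c' 0 * c' 3) • e1 - (c' 0 * c' 1) • e3)
    have z0 : c' 0 * c' 1 * c' 3 - c' 1 * c' 3 * c 0 = 0 := hz 0
    have z1 : c' 0 * c' 1 * c' 3 - c' 0 * c' 3 * c 1 = 0 := hz 1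
    have z3 : c' 0 * c' 1 * c' 3 - c' 0 * c' 1 * c 3 = 0 := hz 2
    have c0 : c 0 = c' 0 := mul_left_cancel₀ (mul_ne_zero (hc' 1) (hc' 3))
      (by linear_combination -z0)
    have c1 : c 1 = c' 1 := mul_left_cancel₀ (mul_ne_zero (hc' 0) (hc' 3))
      (by linear_combination -z1)
    have c3 : c 3 = c' 3 := mul_left_cancel₀ (mul_ne_zero (hc' 0) (hc' 1))
      (by linear_combination -z3)
    rw [← c0] at e0
    rw [← c1] at e1
    rw [← c3] at e3
    have f0 := smul_right_injective V (hc 0) e0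
    have f1 := smul_right_injective V (hc 1) e1
    have f2 := smul_right_injective V (hc 3) e3
    have hee : e = e' := by
      funext i
      fin_cases i <;> assumption
    subst hee
    have c2 : c 2 = c' 2 := sub_eq_zero.1 (hli ![c 2 - c' 2, c 2 - c' 2, 0] (by
      rw [Fin.sum_univ_three]
      simp only [Matrix.cons_val]
      linear_combination (norm := module) e2) 0)
    have c4 : c 4 = c' 4 := sub_eq_zero.1 (hli ![c 4 - c' 4, 0, c 4 - c' 4] (by
      rw [Fin.sum_univ_three]
      simp only [Matrix.cons_val]
      linear_combination (norm := module) e4) 0)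
    have c5 : c 5 = c' 5 := sub_eq_zero.1 (hli ![0, c 5 - c' 5, c 5 - c' 5] (by
      rw [Fin.sum_univ_three]
      simp only [Matrix.cons_val]
      linear_combination (norm := module) e5) 1)
    refine Prod.ext rfl ?_
    funext i
    fin_cases i <;> assumption
  · intro v hv
    obtain ⟨e, c, he, hc, rfl⟩ := (mem_filter.1 hv).2
    exact ⟨(e, c), by simpa using ⟨he, hc⟩, rfl⟩

end Fano

section MainTheorem

open Classical Finset

theorem linIndepCard_eq (K V : Type*) [Field K] [AddCommGroup V] [Module K V] [Fintype K]
    [Fintype V] {n : ℕ} (hn : n ≤ Module.finrank K V) :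
    linIndepCard K V n = ∏ i : Fin n,
      ((Fintype.card K : ℤ) ^ Module.finrank K V - (Fintype.card K : ℤ) ^ (i : ℕ)) := by
  have h := card_linearIndependent (K := K) (V := V) hn
  rw [Nat.card_eq_fintype_card, Fintype.card_subtype] at h
  rw [linIndepCard, h, Nat.cast_prod]
  refine prod_congr rfl fun i _ => ?_
  rw [Nat.cast_sub (Nat.pow_le_pow_right Fintype.card_pos (i.2.le.trans hn))]
  push_cast
  rfl

variable (F : Type*) [Field F] [Fintype F]

theorem vecCapCard_three : vecCapCard F (Fin 4 → F) 3 = linIndepCard F (Fin 4 → F) 3 := by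
  rw [vecCapCard, linIndepCard, filter_congr fun v _ => isVecCap_fin_three]

theorem capCount_mul :
    (capCount F 7 3 : ℤ) * (Fintype.card F - 1) ^ 7 = vecCapCard F (Fin 4 → F) 7 :=
  card_points_mul _ _ fun v => isCap_mkPoints_iff (by norm_num) (by simp) v

theorem realizationCount_mul {n : ℕ} (f : PlanarSpace (Fin n)) (hn : 2 ≤ n)
    (Q : (Fin n → Fin 4 → F) → Prop) [DecidablePred Q]
    (hQ : ∀ v, (PairwiseIndep F v ∧
        (∀ S : Finset (Fin n), OnFlat F 1 v (S : Set (Fin n)) ↔ ∃ L ∈ f.lines, S ⊆ L) ∧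
        (∀ S : Finset (Fin n), OnFlat F 2 v (S : Set (Fin n)) ↔ ∃ H ∈ f.planes, S ⊆ H)) ↔ Q v) :
    (f.realizationCount F : ℤ) * (Fintype.card F - 1) ^ n = (univ.filter Q).card :=
  card_points_mul _ _ fun v => (isStrongRealization_mkPoints_iff hn f v).trans (hQ v)

theorem realizationCount_hyp6_mul :
    (PlanarSpace.hyp6.realizationCount F : ℤ) * (Fintype.card F - 1) ^ 6 =
      linIndepCard F (Fin 4 → F) 4 * (Fintype.card F - 1) ^ 4 :=
  (realizationCount_mul F _ (by norm_num) _ fun v => isStrongRealization_iff_isSkew _ {0, 1, 2}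
    (by decide) (by decide) hyp6_lines_iff hyp6_planes_iff v).trans card_isSkew_three_three

theorem realizationCount_h5_mul :
    (PlanarSpace.h5.realizationCount F : ℤ) * (Fintype.card F - 1) ^ 7 =
      linIndepCard F (Fin 4 → F) 4 * ((Fintype.card F - 1) ^ 5 * (Fintype.card F - 2)) :=
  (realizationCount_mul F _ (by norm_num) _ fun v => isStrongRealization_iff_isSkew _ {0, 1, 2, 3}
    (by decide) (by decide) h5_lines_iff h5_planes_iff v).trans card_isSkew_four_three

theorem realizationCount_h6_mul :
    (PlanarSpace.h6.realizationCount F : ℤ) * (Fintype.card F - 1) ^ 7 =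
      linIndepCard F (Fin 4 → F) 3 * (Fintype.card F - 1) ^ 6 * charTwoIndicator F := by
  rw [charTwoIndicator]
  split_ifs with h2
  · rw [mul_one, ← card_fanoVectors]
    refine realizationCount_mul F _ (by norm_num) _ fun v => ⟨fun h =>
      (isFanoFamily_of_isStrongRealization h.1 h.2.1).2, ?_⟩
    rintro ⟨e, c, he, hc, rfl⟩
    exact isStrongRealization_fanoVectors h2 he hc
  · rw [realizationCount_mul F PlanarSpace.h6 (by norm_num) (fun _ => False) fun v =>
      ⟨fun h => h2 (isFanoFamily_of_isStrongRealization h.1 h.2.1).1, False.elim⟩]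
    simp

end MainTheorem

theorem mainTheorem3 (F : Type*) [Field F] [Finite F] (q : ℤ) (hq : q = (Nat.card F : ℤ)) :
    (capCount F 7 3 : ℤ) =
      q ^ 21 + 7 * q ^ 20 - 7 * q ^ 19 - 112 * q ^ 18 - 28 * q ^ 17 + 637 * q ^ 16 - 119 * q ^ 15
        - 1840 * q ^ 14 + 4676 * q ^ 13 - 4949 * q ^ 12 - 1436 * q ^ 11 + 4136 * q ^ 10
        - 107 * q ^ 9 + 7839 * q ^ 8 - 5908 * q ^ 7 - 2184 * q ^ 6 - 4542 * q ^ 5 - 3534 * q ^ 4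
        + 7470 * q ^ 3
        + (70 * q ^ 3 + 70 * q ^ 2 - 560 * q + 280) * (PlanarSpace.hyp6.realizationCount F : ℤ)
        - 105 * (PlanarSpace.h5.realizationCount F : ℤ)
        - 30 * (PlanarSpace.h6.realizationCount F : ℤ) := by
  have := Fintype.ofFinite F
  rw [Nat.card_eq_fintype_card] at hq
  have hdim : Module.finrank F (Fin 4 → F) = 4 := by simp
  have hV : (Fintype.card (Fin 4 → F) : ℤ) = q ^ 4 := by
    rw [hq, Fintype.card_fun, Fintype.card_fin, Nat.cast_pow]
  have hI3 := linIndepCard_eq F (Fin 4 → F) (n := 3) (by rw [hdim]; norm_num)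
  have hI4 := linIndepCard_eq F (Fin 4 → F) (n := 4) (by rw [hdim])
  rw [hdim, Fin.prod_univ_three, ← hq] at hI3
  rw [hdim, Fin.prod_univ_four, ← hq] at hI4
  have h3 := vecCapCard_three F
  have h4 := vecCapCard_four (K := F) (V := Fin 4 → F)
  have h5 := vecCapCard_five (K := F) (V := Fin 4 → F)
  have h6 := vecCapCard_six (K := F) (V := Fin 4 → F)
  have h7 := vecCapCard_seven (K := F) (V := Fin 4 → F)
  have d0 := depCapCard_zero (K := F) (V := Fin 4 → F)
  have d1 := depCapCard_one (K := F) (V := Fin 4 → F)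
  have d2 := depCapCard_two (K := F) (V := Fin 4 → F)
  have p := planarCapCard_eq (K := F) (V := Fin 4 → F)
  have c := concurrentCapCard_eq (K := F) (V := Fin 4 → F)
  rw [card_sixOnLines] at c
  have a7 := capCount_mul F
  have a6 := realizationCount_hyp6_mul F
  have b5 := realizationCount_h5_mul F
  have b6 := realizationCount_h6_mul F
  rw [hV] at h4 h5 h6 h7 d1 d2
  rw [← hq] at h4 h5 h6 h7 d0 d1 d2 p c a7 a6 b5 b6
  rw [h3] at d0 h4
  rw [d0] at p d1 h5
  rw [p, d1] at d2
  rw [h4] at h5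
  rw [h5, d1] at h6
  rw [h6, d2, c] at h7
  rw [h7] at a7
  simp only [Fin.val_zero, Fin.val_one, Fin.val_two, pow_zero, pow_one] at hI3 hI4
  rw [show ((3 : Fin 4) : ℕ) = 3 from rfl] at hI4
  have hq1 : q - 1 ≠ 0 := by
    have := Fintype.one_lt_card (α := F)
    have : (1 : ℤ) < q := by rw [hq]; exact_mod_cast this
    omega
  refine mul_right_cancel₀ (pow_ne_zero 7 hq1) ?_
  rw [a7]
  rw [hI4] at a6 b5 ⊢
  rw [hI3] at b6 ⊢
  linear_combination -(70 * q ^ 3 + 70 * q ^ 2 - 560 * q + 280) * (q - 1) * a6 + 105 * b5 + 30 * b6
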